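/- Let $Y=(Y,J)$ be a Kähler manifold, that is, a (Hausdorff, $\sigma$-compact, finite-dimensional) complex manifold with complex structure $J$ and a smooth Hermitian metric $h$ whose imaginary part $\omega=\operatorname{Im}h$ is a closed 2-form, so that $\omega$ is a symplectic form on the underlying smooth manifold. Let $[K]\in H^2(Y;\mathbb Q)$ be the canonical class of $Y$, that is, the rational first Chern class of the canonical line bundle $K$ of $Y$. Suppose that there is no diffeomorphism $f:Y\to Y$ with $f^*[K]=-[K]$. Call two symplectic forms on $Y$ equivalent if one can be obtained from the other by a deformation, that is, a path $(\omega_t)_{t\in[0,1]}$ of symplectic forms which is continuous in $t$ (its coefficients in charts are jointly continuous in $t$ and the point), followed by a diffeomorphism of $Y$. Call two almost-complex structures on $Y$ equivalent if one can be obtained from the other by a deformation, that is, a path of almost-complex structures which is continuous in $t$ in the same sense, followed by a diffeomorphism of $Y$. Diffeomorphisms are not required to preserve an orientation. Then the symplectic forms $\omega$ and $-\omega$ are not equivalent; in particular, they are not symplectomorphic, i.e. there is no diffeomorphism $f:Y\to Y$ with $f^*(-\omega)=\omega$. Likewise, the almost-complex structures $J$ and $-J$ are not equivalent; in particular, no diffeomorphism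 of $Y$ carries $J$ to $-J$. -/

import Mathlib

open scoped Manifold ContDiff Topology ComplexConjugate

/-! ### Second Čech cohomology with rational coefficients

Open covers are indexed by the points of the space (`U x` is an open neighbourhood of `x`).  These
covers are cofinal among all open covers and directed under pointwise inclusion, with the identity
as refinement map on indices, so the direct limit of their Čech complexes computes Čech cohomology.
A cochain is written as a total function; only its values on the relevant intersections of some
sufficiently fine cover matter. -/

/-- An open cover indexed by points: `U x` is an open neighbourhood of `x`. -/
structure PointedCover (X : Type*) [TopologicalSpace X] where
  set : X → Set X
  isOpen_set : ∀ x, IsOpen (set x)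
  mem_set : ∀ x, x ∈ set x

namespace PointedCover

variable {X Y : Type*} [TopologicalSpace X] [TopologicalSpace Y]

/-- Common refinement of two covers. -/
def inf (U V : PointedCover X) : PointedCover X where
  set x := U.set x ∩ V.set x
  isOpen_set x := (U.isOpen_set x).inter (V.isOpen_set x)
  mem_set x := ⟨U.mem_set x, V.mem_set x⟩

/-- The one-element cover. -/
def univ : PointedCover X where
  set _ := Set.univ
  isOpen_set _ := isOpen_univ
  mem_set _ := Set.mem_univ _

/-- Pulled back cover. -/
def comap (f : C(X, Y)) (U : PointedCover Y) : PointedCover X where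
  set x := f ⁻¹' U.set (f x)
  isOpen_set x := (U.isOpen_set (f x)).preimage f.continuous
  mem_set x := U.mem_set (f x)

end PointedCover

/-- `b` is locally constant on the (open) set `s`. -/
def LocallyConstOn {X : Type*} [TopologicalSpace X] (b : X → ℚ) (s : Set X) : Prop :=
  ∀ p ∈ s, ∀ᶠ q in 𝓝 p, b q = b p

/-- Čech 2-cocycles with coefficients in the constant sheaf `ℚ`, on some cover. -/
def cechCocycles (X : Type*) [TopologicalSpace X] : AddSubgroup (X → X → X → X → ℚ) where
  carrier := {c | ∃ U : PointedCover X,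
    (∀ i j k, LocallyConstOn (c i j k) (U.set i ∩ U.set j ∩ U.set k)) ∧
    ∀ i j k l, ∀ p ∈ U.set i ∩ U.set j ∩ U.set k ∩ U.set l,
      c j k l p - c i k l p + c i j l p - c i j k p = 0}
  zero_mem' := ⟨PointedCover.univ, fun _ _ _ _ _ => by simp, by simp⟩
  add_mem' := by
    rintro a b ⟨U, hU, hU'⟩ ⟨V, hV, hV'⟩
    refine ⟨U.inf V, fun i j k p hp => ?_, fun i j k l p hp => ?_⟩
    · filter_upwards [hU i j k p ⟨⟨hp.1.1.1, hp.1.2.1⟩, hp.2.1⟩,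
        hV i j k p ⟨⟨hp.1.1.2, hp.1.2.2⟩, hp.2.2⟩] with q h1 h2
      simp [h1, h2]
    · have h1 := hU' i j k l p ⟨⟨⟨hp.1.1.1.1, hp.1.1.2.1⟩, hp.1.2.1⟩, hp.2.1⟩
      have h2 := hV' i j k l p ⟨⟨⟨hp.1.1.1.2, hp.1.1.2.2⟩, hp.1.2.2⟩, hp.2.2⟩
      simp only [Pi.add_apply]
      linarith
  neg_mem' := by
    rintro a ⟨U, hU, hU'⟩
    refine ⟨U, fun i j k p hp => ?_, fun i j k l p hp => ?_⟩
    · filter_upwards [hU i j k p hp] with q h1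
      simp [h1]
    · have h1 := hU' i j k l p hp
      simp only [Pi.neg_apply]
      linarith

/-- Functions that are, on some cover, the Čech coboundary of a locally constant 1-cochain. -/
def cechCoboundaries (X : Type*) [TopologicalSpace X] : AddSubgroup (X → X → X → X → ℚ) where
  carrier := {c | ∃ U : PointedCover X, ∃ b : X → X → X → ℚ,
    (∀ i j, LocallyConstOn (b i j) (U.set i ∩ U.set j)) ∧
    ∀ i j k, ∀ p ∈ U.set i ∩ U.set j ∩ U.set k, c i j k p = b j k p - b i k p + b i j p}
  zero_mem' := ⟨PointedCover.univ, 0, fun _ _ _ _ => by simp, by simp⟩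
  add_mem' := by
    rintro a a' ⟨U, b, hU, hU'⟩ ⟨V, b', hV, hV'⟩
    refine ⟨U.inf V, b + b', fun i j p hp => ?_, fun i j k p hp => ?_⟩
    · filter_upwards [hU i j p ⟨hp.1.1, hp.2.1⟩, hV i j p ⟨hp.1.2, hp.2.2⟩] with q h1 h2
      simp [h1, h2]
    · have h1 := hU' i j k p ⟨⟨hp.1.1.1, hp.1.2.1⟩, hp.2.1⟩
      have h2 := hV' i j k p ⟨⟨hp.1.1.2, hp.1.2.2⟩, hp.2.2⟩
      simp only [Pi.add_apply]
      linarith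
  neg_mem' := by
    rintro a ⟨U, b, hU, hU'⟩
    refine ⟨U, -b, fun i j p hp => ?_, fun i j k p hp => ?_⟩
    · filter_upwards [hU i j p hp] with q h1
      simp [h1]
    · have h1 := hU' i j k p hp
      simp only [Pi.neg_apply]
      linarith

/-- The cohomology group `H²(X; ℚ)`. -/
abbrev CechH2 (X : Type*) [TopologicalSpace X] : Type _ :=
  ↥(cechCocycles X) ⧸ (cechCoboundaries X).addSubgroupOf (cechCocycles X)

/-- Pull-back of cocycles along a continuous map. -/
def cechPullbackCocycles {X Y : Type*} [TopologicalSpace X] [TopologicalSpace Y] (f : C(X, Y)) :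
    ↥(cechCocycles Y) →+ ↥(cechCocycles X) where
  toFun c := ⟨fun i j k p => c.1 (f i) (f j) (f k) (f p), by
    obtain ⟨c, U, hU, hU'⟩ := c
    refine ⟨U.comap f, fun i j k p hp => ?_, fun i j k l p hp => ?_⟩
    · exact (f.continuous.tendsto p).eventually (hU (f i) (f j) (f k) (f p) hp)
    · exact hU' (f i) (f j) (f k) (f l) (f p) hp⟩
  map_zero' := rfl
  map_add' _ _ := rfl

/-- The induced map `f^* : H²(Y; ℚ) → H²(X; ℚ)` of a continuous map `f : X → Y`. -/
def cechPullback {X Y : Type*} [TopologicalSpace X] [TopologicalSpace Y] (f : C(X, Y)) :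
    CechH2 Y →+ CechH2 X :=
  QuotientAddGroup.map _ _ (cechPullbackCocycles f) (by
    rintro c ⟨U, b, hU, hU'⟩
    refine ⟨U.comap f, fun i j p => b (f i) (f j) (f p), fun i j p hp => ?_, fun i j k p hp => ?_⟩
    · exact (f.continuous.tendsto p).eventually (hU (f i) (f j) (f p) hp)
    · exact hU' (f i) (f j) (f k) (f p) hp)

/-! ### Tensor fields on a manifold modelled on `E` -/

section Forms

variable (𝕜 : Type*) [NontriviallyNormedField 𝕜] {E : Type*} [NormedAddCommGroup E]
  [NormedSpace 𝕜 E] (M : Type*) [TopologicalSpace M] [ChartedSpace E M]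

/-- (Not necessarily continuous) fields of `𝕜`-multilinear alternating `k`-forms on the tangent
spaces of `M`, with values in `F`. -/
abbrev FormField (k : ℕ) (F : Type*) [NormedAddCommGroup F] [NormedSpace 𝕜 F] : Type _ :=
  ∀ x : M, TangentSpace 𝓘(𝕜, E) x [⋀^Fin k]→L[𝕜] F

variable {M} {k : ℕ} {F : Type*} [NormedAddCommGroup F] [NormedSpace 𝕜 F]

/-- The expression of a form field in the chart at `x₀`: its pull-back by the inverse of the chart,
meaningful on the target of the chart. -/
noncomputable def FormField.inChart (a : FormField 𝕜 (E := E) M k F) (x₀ : M) (y : E) :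
    E [⋀^Fin k]→L[𝕜] F :=
  (a ((chartAt E x₀).symm y)).compContinuousLinearMap
    (mfderiv 𝓘(𝕜, E) 𝓘(𝕜, E) (chartAt E x₀).symm y)

end Forms

section Real

variable {E : Type*} [NormedAddCommGroup E] [NormedSpace ℝ E]
  {M : Type*} [TopologicalSpace M] [ChartedSpace E M]

/-- A symplectic form: a smooth, closed, nondegenerate real 2-form. -/
structure IsSymplecticForm (a : FormField ℝ (E := E) M 2 ℝ) : Prop where
  smooth : ∀ x₀ : M, ContDiffOn ℝ ∞ (a.inChart ℝ x₀) (chartAt E x₀).target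
  closed : ∀ x₀ : M, ∀ y ∈ (chartAt E x₀).target, extDeriv (a.inChart ℝ x₀) y = 0
  nondegenerate : ∀ (x : M) (v : TangentSpace 𝓘(ℝ, E) x), (∀ w, a x ![v, w] = 0) → v = 0

/-- `a` is the pull-back `f^* b`. -/
def IsPullbackForm (f : M ≃ₘ^∞⟮𝓘(ℝ, E), 𝓘(ℝ, E)⟯ M) (a b : FormField ℝ (E := E) M 2 ℝ) : Prop :=
  ∀ x, a x = (b (f x)).compContinuousLinearMap (mfderiv 𝓘(ℝ, E) 𝓘(ℝ, E) f x)

/-- `f^* b = a` for some diffeomorphism `f`. -/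
def Symplectomorphic (a b : FormField ℝ (E := E) M 2 ℝ) : Prop :=
  ∃ f : M ≃ₘ^∞⟮𝓘(ℝ, E), 𝓘(ℝ, E)⟯ M, IsPullbackForm f a b

/-- A deformation of symplectic forms: a path of symplectic forms whose coefficients in charts
depend continuously on the parameter and the point together. -/
structure IsSymplecticDeformation (a : unitInterval → FormField ℝ (E := E) M 2 ℝ) : Prop where
  symplectic : ∀ t, IsSymplecticForm (a t)
  continuous : ∀ x₀ : M, ContinuousOn
    (fun q : unitInterval × E => (a q.1).inChart ℝ x₀ q.2) (Set.univ ×ˢ (chartAt E x₀).target)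

/-- `b` is obtained from `a` by a deformation followed by a diffeomorphism. -/
def SymplecticEquivalent (a b : FormField ℝ (E := E) M 2 ℝ) : Prop :=
  ∃ s : unitInterval → FormField ℝ (E := E) M 2 ℝ,
    IsSymplecticDeformation s ∧ s 0 = a ∧ Symplectomorphic (s 1) b

variable (E M) in
/-- (Not necessarily continuous) fields of endomorphisms of the tangent spaces. -/
abbrev EndField : Type _ := ∀ x : M, TangentSpace 𝓘(ℝ, E) x →L[ℝ] TangentSpace 𝓘(ℝ, E) x

/-- The expression of a field of endomorphisms in the chart at `x₀`. -/
noncomputable def EndField.inChart (J : EndField E M) (x₀ : M) (y : E) : E →L[ℝ] E :=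
  (mfderiv 𝓘(ℝ, E) 𝓘(ℝ, E) (chartAt E x₀) ((chartAt E x₀).symm y)).comp
    ((J ((chartAt E x₀).symm y)).comp (mfderiv 𝓘(ℝ, E) 𝓘(ℝ, E) (chartAt E x₀).symm y))

/-- An almost-complex structure: a smooth field of endomorphisms with `J² = -1`. -/
structure IsAlmostComplex (J : EndField E M) : Prop where
  smooth : ∀ x₀ : M, ContDiffOn ℝ ∞ (J.inChart x₀) (chartAt E x₀).target
  sq : ∀ (x : M) (v : TangentSpace 𝓘(ℝ, E) x), J x (J x v) = -v

/-- Some diffeomorphism of `M` carries `J` to `J'`. -/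
def AlmostComplexIsomorphic (J J' : EndField E M) : Prop :=
  ∃ f : M ≃ₘ^∞⟮𝓘(ℝ, E), 𝓘(ℝ, E)⟯ M, ∀ (x : M) (v : TangentSpace 𝓘(ℝ, E) x),
    mfderiv 𝓘(ℝ, E) 𝓘(ℝ, E) f x (J x v) = J' (f x) (mfderiv 𝓘(ℝ, E) 𝓘(ℝ, E) f x v)

/-- A deformation of almost-complex structures. -/
structure IsAlmostComplexDeformation (J : unitInterval → EndField E M) : Prop where
  almostComplex : ∀ t, IsAlmostComplex (J t)
  continuous : ∀ x₀ : M, ContinuousOn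
    (fun q : unitInterval × E => (J q.1).inChart x₀ q.2) (Set.univ ×ˢ (chartAt E x₀).target)

/-- `J'` is obtained from `J` by a deformation followed by a diffeomorphism. -/
def AlmostComplexEquivalent (J J' : EndField E M) : Prop :=
  ∃ s : unitInterval → EndField E M,
    IsAlmostComplexDeformation s ∧ s 0 = J ∧ AlmostComplexIsomorphic (s 1) J'

end Real

/-! ### Complex manifolds -/

section Complex

variable (E : Type*) [NormedAddCommGroup E] [NormedSpace ℂ E]
  (M : Type*) [TopologicalSpace M] [ChartedSpace E M]

/-- The almost-complex structure of a complex manifold.  The tangent space at `x` is `E`, through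
the preferred chart at `x`; charts being holomorphic, multiplication by `i` does not depend on the
chart. -/
noncomputable def complexStructure : EndField E M := fun _ =>
  ((Complex.I • ContinuousLinearMap.id ℂ E).restrictScalars ℝ : E →L[ℝ] E)

/-- A smooth Hermitian metric on a complex manifold, conjugate-linear in the first variable. -/
structure HermitianMetric where
  form : ∀ x : M, TangentSpace 𝓘(ℂ, E) x →L⋆[ℂ] TangentSpace 𝓘(ℂ, E) x →L[ℂ] ℂ
  conj_symm : ∀ (x : M) (v w : TangentSpace 𝓘(ℂ, E) x), form x w v = conj (form x v w)
  pos : ∀ (x : M) (v : TangentSpace 𝓘(ℂ, E) x), v ≠ 0 → 0 < (form x v v).re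
  smooth : ∀ (x₀ : M) (v w : E), ContDiffOn ℝ ∞
    (fun y : E => form ((chartAt E x₀).symm y)
      (mfderiv 𝓘(ℂ, E) 𝓘(ℂ, E) (chartAt E x₀).symm y v)
      (mfderiv 𝓘(ℂ, E) 𝓘(ℂ, E) (chartAt E x₀).symm y w)) (chartAt E x₀).target

variable {E M}

/-- The real 2-form `Im h` of a Hermitian metric `h`. -/
noncomputable def HermitianMetric.imForm (h : HermitianMetric E M) :
    FormField ℝ (E := E) M 2 ℝ := fun x =>
  let b : E →L⋆[ℂ] E →L[ℂ] ℂ := h.form x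
  have b_smul : ∀ (r : ℝ) (v : E), b (r • v) = r • b v := fun r v => by
    rw [← Complex.coe_smul, b.map_smulₛₗ, Complex.conj_ofReal, Complex.coe_smul]
  have b_smul' : ∀ (r : ℝ) (v w : E), b v (r • w) = r • b v w := fun r v w => by
    rw [← Complex.coe_smul, map_smul, Complex.coe_smul]
  show E [⋀^Fin 2]→L[ℝ] ℝ from
  { toFun := fun v => (b (v 0) (v 1)).im
    map_update_add' := fun v i p q => by
      rename_i d
      obtain rfl := Subsingleton.elim d (fun a b => instDecidableEqFin 2 a b)
      fin_cases i <;> simp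
    map_update_smul' := fun v i r p => by
      rename_i d
      obtain rfl := Subsingleton.elim d (fun a b => instDecidableEqFin 2 a b)
      fin_cases i <;> simp [b_smul, b_smul']
    cont := by fun_prop
    map_eq_zero_of_eq' := fun v i j hij hne => by
      have h01 : v 0 = v 1 := by
        fin_cases i <;> fin_cases j <;> simp_all
      have := congrArg Complex.im (h.conj_symm x (v 0) (v 0))
      simp only [Complex.conj_im] at this
      change (h.form x (v 0) (v 1)).im = 0
      rw [← h01]
      linarith }

/-- A Hermitian metric is Kähler if its imaginary part is closed. -/
def HermitianMetric.IsKahler (h : HermitianMetric E M) : Prop :=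
  ∀ x₀ : M, ∀ y ∈ (chartAt E x₀).target, extDeriv (h.imForm.inChart ℝ x₀) y = 0

/-- `θ` is a continuous frame over `U` of the canonical line bundle `K`, the top exterior power of
the holomorphic cotangent bundle. -/
structure IsCanonicalFrameOn
    (θ : FormField ℂ (E := E) M (Module.finrank ℂ E) ℂ) (U : Set M) : Prop where
  continuousOn : ∀ x₀ : M, ContinuousOn (θ.inChart ℂ x₀)
    ((chartAt E x₀).target ∩ (chartAt E x₀).symm ⁻¹' U)
  ne_zero : ∀ p ∈ U, θ p ≠ 0

variable (E) in
/-- `κ` is the canonical class `[K] ∈ H²(M; ℚ)`, that is, the first Chern class of `K`: the image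
of `K` under the connecting map of the exponential sequence.  For local frames `θ i` with
`θ j = exp (2πi · l i j) θ i`, it is the class of the cocycle `l i j + l j k - l i k`. -/
def IsCanonicalClass (κ : CechH2 M) : Prop :=
  ∃ (U : PointedCover M) (θ : M → FormField ℂ (E := E) M (Module.finrank ℂ E) ℂ)
    (l : M → M → M → ℂ) (c : ↥(cechCocycles M)),
    (∀ i, IsCanonicalFrameOn (θ i) (U.set i)) ∧
    (∀ i j, ContinuousOn (l i j) (U.set i ∩ U.set j)) ∧
    (∀ i j, ∀ p ∈ U.set i ∩ U.set j,
      θ j p = Complex.exp (2 * Real.pi * Complex.I * l i j p) • θ i p) ∧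
    (∀ i j k, ∀ p ∈ U.set i ∩ U.set j ∩ U.set k,
      (c.1 i j k p : ℂ) = l i j p + l j k p - l i k p) ∧
    κ = (c : CechH2 M)

end Complex

/-! ### Derivatives of charts -/

/-! Each of the four relations would produce a diffeomorphism `f` with `f^*[K] = -[K]`. Suppose
first that a path `J_t` of complex structures on the tangent bundle joins `i` to the pull-back of
`-i` by `f`. For `J'` close to `J`, the operator `(1 - J'J)/2` is invertible and intertwines `J` and
`J'`. Multiplying such operators along the path gives a bundle isomorphism `Ψ` from `J_0` to `J_1`
(`exists_intertwining_of_path`), and `df ∘ Ψ` is then a conjugate-linear isomorphism of the tangent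
bundle over `f`. Pulling back local frames of `K` along it and conjugating yields frames of `K`
again. Hence `f^*K` is isomorphic to the conjugate of `K` as a complex line bundle, and the
exponential sequence gives `f^*[K] = -[K]` (`cechPullback_eq_neg_of_conjLinear`).

The symplectic case reduces to this one. Given a path `Ω_t` of nondegenerate 2-forms from `ω` to
`f^*(-ω)`, let `g_t` be the segment of metrics from `Re h` to `f^*(Re h)`, and let `A_t` be the skew
operator representing `Ω_t` with respect to `g_t`. Its polar part `A_t (-A_t²)^(-1/2)` is a complex
structure depending continuously on all data (`continuousOperators_polarPart`). At both ends `A_t`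
already squares to `-1`, so the polar parts there are `i` and the pull-back of `-i`. -/

lemma eventually_mem_chart_source {E M : Type*} [TopologicalSpace E] [TopologicalSpace M]
    [ChartedSpace E M] (p : M) : ∀ᶠ x in 𝓝 p, x ∈ (chartAt E p).source :=
  (chartAt E p).open_source.mem_nhds (mem_chart_source E p)

section RealCharts

variable {E : Type*} [NormedAddCommGroup E] [NormedSpace ℝ E]
  {M : Type*} [TopologicalSpace M] [ChartedSpace E M]

/-- The derivative at `x` of the chart at `p`. -/
noncomputable def chartDeriv (p x : M) : E →L[ℝ] E :=
  mfderiv 𝓘(ℝ, E) 𝓘(ℝ, E) (chartAt E p) x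

/-- The derivative of the inverse of the chart at `p`, at the point of the chart over `x`. -/
noncomputable def chartSymmDeriv (p x : M) : E →L[ℝ] E :=
  mfderiv 𝓘(ℝ, E) 𝓘(ℝ, E) (chartAt E p).symm (chartAt E p x)

/-- The derivative of a map, as an operator on the model space. -/
noncomputable def modelDeriv (f : M → M) (x : M) : E →L[ℝ] E := mfderiv 𝓘(ℝ, E) 𝓘(ℝ, E) f x

variable [IsManifold 𝓘(ℝ, E) 1 M]

lemma chartSymmDeriv_comp_chartDeriv {p x : M} (hx : x ∈ (chartAt E p).source) :
    (chartSymmDeriv (E := E) p x).comp (chartDeriv p x) = ContinuousLinearMap.id ℝ E :=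
  (mdifferentiable_chart (I := 𝓘(ℝ, E)) p).symm_comp_deriv hx

lemma chartDeriv_comp_chartSymmDeriv {p x : M} (hx : x ∈ (chartAt E p).source) :
    (chartDeriv (E := E) p x).comp (chartSymmDeriv p x) = ContinuousLinearMap.id ℝ E := by
  have h := (mdifferentiable_chart (I := 𝓘(ℝ, E)) p).comp_symm_deriv
    ((chartAt E p).map_source hx)
  rw [(chartAt E p).left_inv hx] at h
  exact h

lemma chartSymmDeriv_chartDeriv_apply {p x : M} (hx : x ∈ (chartAt E p).source) (v : E) :
    chartSymmDeriv (E := E) p x (chartDeriv p x v) = v :=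
  DFunLike.congr_fun (chartSymmDeriv_comp_chartDeriv hx) v

lemma chartDeriv_chartSymmDeriv_apply {p x : M} (hx : x ∈ (chartAt E p).source) (v : E) :
    chartDeriv (E := E) p x (chartSymmDeriv p x v) = v :=
  DFunLike.congr_fun (chartDeriv_comp_chartSymmDeriv hx) v

/-- The derivative of a `C¹` map depends continuously on the point, in charts. -/
lemma continuousAt_mfderiv_inChart {f : M → M} (hf : ContMDiff 𝓘(ℝ, E) 𝓘(ℝ, E) ∞ f) (p : M) :
    ContinuousAt (fun x => (chartDeriv (E := E) (f p) (f x)).comp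
      ((modelDeriv f x).comp (chartSymmDeriv p x))) p := by
  have h := (ContMDiffAt.mfderiv_const (m := 0) (hf p) (by simp)).continuousAt
  refine h.congr ?_
  filter_upwards [eventually_mem_chart_source (E := E) p,
    hf.continuous.continuousAt.preimage_mem_nhds
      ((chartAt E (f p)).open_source.mem_nhds (mem_chart_source E (f p)))] with x hx hfx
  rw [inTangentCoordinates_eq_mfderiv_comp hx hfx]
  simp [chartDeriv, chartSymmDeriv, mfderivWithin_univ]
  rfl

/-- A field of operators along `f`, in the charts at `p` and `f p`, is a composition. -/
lemma chart_comp_comp {p x q y : M} (hx : x ∈ (chartAt E p).source) (A : E →L[ℝ] E)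
    (B : E →L[ℝ] E) :
    (chartDeriv (E := E) q y).comp ((B.comp A).comp (chartSymmDeriv p x)) =
      ((chartDeriv q y).comp (B.comp (chartSymmDeriv p x))).comp
        ((chartDeriv p x).comp (A.comp (chartSymmDeriv p x))) := by
  ext v
  simp [chartSymmDeriv_chartDeriv_apply hx]

end RealCharts

section ComplexCharts

variable {E : Type*} [NormedAddCommGroup E] [NormedSpace ℂ E]
  {M : Type*} [TopologicalSpace M] [ChartedSpace E M]

lemma isManifold_real_of_complex [IsManifold 𝓘(ℂ, E) ω M] (n : ℕ∞ω) :
    IsManifold 𝓘(ℝ, E) n M := by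
  refine isManifold_of_contDiffOn _ _ _ fun e e' he he' => ?_
  have h := (contDiffGroupoid ω 𝓘(ℂ, E)).compatible he he'
  rw [contDiffGroupoid, mem_groupoid_of_pregroupoid] at h
  have h1 : ContDiffOn ℂ ω ((e.symm ≫ₕ e' : OpenPartialHomeomorph E E) : E → E)
      (e.symm ≫ₕ e').source := by
    simpa [contDiffPregroupoid] using h.1
  simpa using (h1.restrict_scalars ℝ).of_le le_top

lemma mfderiv_real_eq_restrictScalars {N : Type*} [TopologicalSpace N] [ChartedSpace E N]
    {f : M → N} {x : M} (hf : MDifferentiableAt 𝓘(ℂ, E) 𝓘(ℂ, E) f x) :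
    (mfderiv 𝓘(ℝ, E) 𝓘(ℝ, E) f x : E →L[ℝ] E) =
      (mfderiv 𝓘(ℂ, E) 𝓘(ℂ, E) f x : E →L[ℂ] E).restrictScalars ℝ := by
  have h := hf.hasMFDerivAt
  have h' : HasMFDerivAt 𝓘(ℝ, E) 𝓘(ℝ, E) f x
      ((mfderiv 𝓘(ℂ, E) 𝓘(ℂ, E) f x : E →L[ℂ] E).restrictScalars ℝ) :=
    ⟨h.1, HasFDerivWithinAt.restrictScalars ℝ h.2⟩
  exact h'.mfderiv

variable [IsManifold 𝓘(ℂ, E) ω M]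

lemma mfderiv_chart_symm_apply {p x : M} (hx : x ∈ (chartAt E p).source) (v : E) :
    (mfderiv 𝓘(ℂ, E) 𝓘(ℂ, E) (chartAt E p).symm (chartAt E p x) : E →L[ℂ] E) v =
      chartSymmDeriv (E := E) p x v := by
  have : IsManifold 𝓘(ℂ, E) 1 M := IsManifold.of_le (n := ω) le_top
  have h := (mdifferentiable_chart (I := 𝓘(ℂ, E)) p).2 _ ((chartAt E p).map_source hx)
  have h' := h.mdifferentiableAt ((chartAt E p).open_target.mem_nhds ((chartAt E p).map_source hx))
  rw [chartSymmDeriv, mfderiv_real_eq_restrictScalars h']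
  rfl

lemma chartSymmDeriv_smul_I {p x : M} (hx : x ∈ (chartAt E p).source) (v : E) :
    chartSymmDeriv (E := E) p x (Complex.I • v) = Complex.I • chartSymmDeriv p x v := by
  rw [← mfderiv_chart_symm_apply hx, ← mfderiv_chart_symm_apply hx]
  exact ContinuousLinearMap.map_smul
    (mfderiv 𝓘(ℂ, E) 𝓘(ℂ, E) (chartAt E p).symm (chartAt E p x) : E →L[ℂ] E) _ _

end ComplexCharts

/-! ### Conjugate-linear bundle maps reverse the canonical class -/

section CanonicalClass

variable {E : Type*} [NormedAddCommGroup E] [NormedSpace ℂ E]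

/-- The sign in `f^*[K] = -[K]` comes from here: conjugating a transition function replaces its
logarithm `l` by `-conj l`, while the rational cocycle built from `l` is unchanged by `conj`. -/
lemma conj_exp_two_pi_I (z : ℂ) :
    conj (Complex.exp (2 * Real.pi * Complex.I * z)) =
      Complex.exp (2 * Real.pi * Complex.I * -conj z) := by
  rw [← Complex.exp_conj]
  simp [map_ofNat]

/-- A continuous non-vanishing function has a continuous logarithm near each point. -/
lemma exists_continuousOn_exp_two_pi_I {X : Type*} [TopologicalSpace X] {r : X → ℂ} {p : X}
    {V : Set X} (hV : V ∈ 𝓝 p) (hr : ∀ x ∈ V, ContinuousAt r x) (hp : r p ≠ 0) :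
    ∃ W : Set X, IsOpen W ∧ p ∈ W ∧ W ⊆ V ∧ ∃ m : X → ℂ, ContinuousOn m W ∧
      ∀ x ∈ W, r x = Complex.exp (2 * Real.pi * Complex.I * m x) := by
  -- Dividing by `r p` moves the value at `p` to `1`, where the principal logarithm is continuous.
  have hev : ∀ᶠ x in 𝓝 p, r x / r p ∈ Complex.slitPlane := by
    have h : ContinuousAt (fun x => r x / r p) p := (hr p (mem_of_mem_nhds hV)).div_const _
    refine h.eventually (Complex.isOpen_slitPlane.mem_nhds ?_)
    simp [hp]
  obtain ⟨W, hW, hWo, hpW⟩ := eventually_nhds_iff.1 (hev.and hV)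
  refine ⟨W, hWo, hpW, fun x hx => (hW x hx).2,
    fun x => (Complex.log (r x / r p) + Complex.log (r p)) / (2 * Real.pi * Complex.I), ?_, ?_⟩
  · intro x hx
    refine ContinuousAt.continuousWithinAt ?_
    have h := ((hr x (hW x hx).2).div_const (r p)).clog (hW x hx).1
    exact (h.add continuousAt_const).div_const _
  · intro x hx
    have h0 : r x / r p ≠ 0 := Complex.slitPlane_ne_zero (hW x hx).1
    rw [mul_div_cancel₀ _ Complex.two_pi_I_ne_zero, Complex.exp_add, Complex.exp_log h0,
      Complex.exp_log hp, div_mul_cancel₀ _ hp]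

/-- A continuous function whose values are integers is locally constant. -/
lemma locallyConstOn_round_re {X : Type*} [TopologicalSpace X] {g : X → ℂ} {s : Set X}
    (hs : IsOpen s) (hg : ContinuousOn g s) (hint : ∀ x ∈ s, ∃ n : ℤ, g x = n) :
    LocallyConstOn (fun x => ((round (g x).re : ℤ) : ℚ)) s := by
  intro p hp
  have hc := hg.continuousAt (hs.mem_nhds hp)
  filter_upwards [hc.eventually (Metric.ball_mem_nhds (g p) one_pos), hs.mem_nhds hp]
    with q hq hqs
  obtain ⟨n, hn⟩ := hint p hp
  obtain ⟨k, hk⟩ := hint q hqs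
  rw [hn, hk, dist_eq_norm, ← Int.cast_sub, Complex.norm_intCast] at hq
  have : k - n = 0 := Int.abs_lt_one_iff.1 (by exact_mod_cast hq)
  rw [hn, hk, sub_eq_zero.1 this]

/-- The conjugate of the pull-back of a complex alternating form by a conjugate-linear map. -/
noncomputable def conjPullback {n : ℕ} (θ : E [⋀^Fin n]→L[ℂ] ℂ) (L : E →L[ℝ] E)
    (hL : ∀ v, L (Complex.I • v) = -(Complex.I • L v)) : E [⋀^Fin n]→ₗ[ℂ] ℂ where
  toFun v := conj (θ fun k => L (v k))
  map_update_add' v i a b := by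
    have h (c : E) : (fun k => L (Function.update v i c k)) =
        Function.update (fun k => L (v k)) i (L c) := by
      ext k
      by_cases hk : k = i
      · subst hk; simp
      · simp [hk]
    have hu := θ.map_update_add (fun k => L (v k)) i (L a) (L b)
    simp only [h, map_add] at hu ⊢
    rw [θ.map_update_add, map_add]
  map_update_smul' v i c a := by
    have h (c : E) : (fun k => L (Function.update v i c k)) =
        Function.update (fun k => L (v k)) i (L c) := by
      ext k
      by_cases hk : k = i
      · subst hk; simp
      · simp [hk]
    have hc : L (c • a) = conj c • L a := by
      conv_lhs => rw [← Complex.re_add_im c, add_smul, mul_smul, map_add, Complex.coe_smul,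
        Complex.coe_smul, map_smul, map_smul, hL]
      have hcc : conj c = (c.re : ℂ) - c.im * Complex.I := by
        apply Complex.ext <;> simp
      rw [hcc, sub_smul, mul_smul, Complex.coe_smul, Complex.coe_smul, smul_neg, sub_eq_add_neg]
    simp only [h, hc]
    rw [θ.map_update_smul]
    simp
  map_eq_zero_of_eq' v i j hv hij := by
    rw [θ.map_eq_zero_of_eq _ (by simp [hv]) hij, map_zero]

lemma alternating_apply_basis_ne_zero {n : ℕ} (b : Module.Basis (Fin n) ℂ E)
    {θ : E [⋀^Fin n]→L[ℂ] ℂ} (hθ : θ ≠ 0) : θ b ≠ 0 :=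
  (AlternatingMap.map_basis_ne_zero_iff b θ.toAlternatingMap).2 fun h =>
    hθ (ContinuousAlternatingMap.toAlternatingMap_injective h)

/-- Top-degree forms are proportional. -/
lemma top_forms_proportional {n : ℕ} (b : Module.Basis (Fin n) ℂ E)
    (α β : E [⋀^Fin n]→ₗ[ℂ] ℂ) (v : Fin n → E) : α b * β v = β b * α v := by
  rw [AlternatingMap.eq_smul_basis_det b α, AlternatingMap.eq_smul_basis_det b β]
  simp
  ring

/-- The value at `x` of a form field, as a form on the model space. -/
def FormField.onModel {M : Type*} [TopologicalSpace M] [ChartedSpace E M] {n : ℕ}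
    (θ : FormField ℂ (E := E) M n ℂ) (x : M) : E [⋀^Fin n]→L[ℂ] ℂ := θ x

lemma apply_eq_inChart {M : Type*} [TopologicalSpace M] [ChartedSpace E M]
    [IsManifold 𝓘(ℂ, E) ω M] {n : ℕ} (θ : FormField ℂ (E := E) M n ℂ) {p x : M}
    (hx : x ∈ (chartAt E p).source) (w : Fin n → E) :
    θ.onModel x (fun k => chartSymmDeriv (E := E) p x (w k)) =
      θ.inChart ℂ p (chartAt E p x) w := by
  have h : θ.inChart ℂ p (chartAt E p x) w =
      θ.onModel ((chartAt E p).symm (chartAt E p x)) (fun k =>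
        (mfderiv 𝓘(ℂ, E) 𝓘(ℂ, E) (chartAt E p).symm (chartAt E p x) : E →L[ℂ] E) (w k)) := rfl
  simp only [h, mfderiv_chart_symm_apply hx]
  rw [(chartAt E p).left_inv hx]

variable {M : Type*} [TopologicalSpace M] [ChartedSpace E M]

lemma IsCanonicalFrameOn.continuousAt_inChart
    {θ : FormField ℂ (E := E) M (Module.finrank ℂ E) ℂ} {U : Set M}
    (hθ : IsCanonicalFrameOn θ U) (hU : IsOpen U) {p : M} (hp : p ∈ U) :
    ContinuousAt (fun x => θ.inChart ℂ p (chartAt E p x)) p := by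
  have ho : IsOpen ((chartAt E p).target ∩ (chartAt E p).symm ⁻¹' U) :=
    (chartAt E p).symm.isOpen_inter_preimage hU
  have hm : chartAt E p p ∈ (chartAt E p).target ∩ (chartAt E p).symm ⁻¹' U := by
    refine ⟨mem_chart_target E p, ?_⟩
    rwa [Set.mem_preimage, (chartAt E p).left_inv (mem_chart_source E p)]
  exact ((hθ.continuousOn p).continuousAt (ho.mem_nhds hm)).comp
    ((chartAt E p).continuousAt (mem_chart_source E p))

variable [IsManifold 𝓘(ℂ, E) ω M]

/-- The ratio of the conjugated pull-back of a local frame to another local frame is continuous. -/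
lemma continuousAt_conjPullback_div (b : Module.Basis (Fin (Module.finrank ℂ E)) ℂ E)
    {f : M → M} {L : M → E →L[ℝ] E} (hL : ∀ x v, L x (Complex.I • v) = -(Complex.I • L x v))
    {θ θ' : FormField ℂ (E := E) M (Module.finrank ℂ E) ℂ} {U U' : Set M}
    (hθ : IsCanonicalFrameOn θ U) (hU : IsOpen U)
    (hθ' : IsCanonicalFrameOn θ' U') (hU' : IsOpen U')
    {p : M} (hf : ContinuousAt f p) (hp : p ∈ U) (hp' : f p ∈ U')
    (hLp : ContinuousAt (fun x => (chartDeriv (E := E) (f p) (f x)).comp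
      ((L x).comp (chartSymmDeriv p x))) p) :
    ContinuousAt (fun x => conjPullback (θ'.onModel (f x)) (L x) (hL x) b / θ.onModel x b) p := by
  have : IsManifold 𝓘(ℝ, E) 1 M := isManifold_real_of_complex 1
  have hnum : ContinuousAt (fun x => conj (θ'.inChart ℂ (f p) (chartAt E (f p) (f x))
      (fun k => (chartDeriv (E := E) (f p) (f x)).comp
        ((L x).comp (chartSymmDeriv p x)) (b k)))) p := by
    have h1 : ContinuousAt (fun x => (θ'.inChart ℂ (f p)
        (chartAt E (f p) (f x))).toContinuousMultilinearMap) p :=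
      ContinuousAlternatingMap.continuous_toContinuousMultilinearMap.continuousAt.comp
        (ContinuousAt.comp (f := f) (hθ'.continuousAt_inChart hU' hp') hf)
    have h2 : ContinuousAt (fun x k => (chartDeriv (E := E) (f p) (f x)).comp
        ((L x).comp (chartSymmDeriv p x)) (b k)) p :=
      continuousAt_pi.2 fun k => hLp.clm_apply continuousAt_const
    exact Complex.continuous_conj.continuousAt.comp (h1.eval h2)
  have hden : ContinuousAt (fun x => θ.inChart ℂ p (chartAt E p x) b) p :=
    (ContinuousEvalConst.continuous_eval_const (F := E [⋀^Fin (Module.finrank ℂ E)]→L[ℂ] ℂ)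
      (b : Fin (Module.finrank ℂ E) → E)).continuousAt.comp (hθ.continuousAt_inChart hU hp)
  have hne (x : M) (hx : x ∈ (chartAt E p).source) (hxU : x ∈ U) :
      θ.inChart ℂ p (chartAt E p x) b ≠ 0 := by
    refine alternating_apply_basis_ne_zero b fun h0 => ?_
    refine alternating_apply_basis_ne_zero b (hθ.ne_zero x hxU) ?_
    have h1 := apply_eq_inChart θ hx (fun k => chartDeriv (E := E) p x (b k))
    simp only [chartSymmDeriv_chartDeriv_apply hx, h0] at h1
    exact h1
  have hps := mem_chart_source E p
  refine (hnum.div hden (hne p hps hp)).congr ?_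
  filter_upwards [eventually_mem_chart_source (E := E) p, hU.mem_nhds hp,
    hf.preimage_mem_nhds ((chartAt E (f p)).open_source.mem_nhds (mem_chart_source E (f p)))]
    with x hx hxU hfx
  have hθb : θ.onModel x b ≠ 0 :=
    alternating_apply_basis_ne_zero b (hθ.ne_zero x hxU)
  rw [Pi.div_apply, div_eq_div_iff (hne x hx hxU) hθb]
  rw [← apply_eq_inChart θ hx, ← apply_eq_inChart θ' hfx]
  simp only [ContinuousLinearMap.comp_apply, chartSymmDeriv_chartDeriv_apply hfx]
  -- The tangent space at `x` is identified with `E` through the chart at `x`, so evaluations on the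
  -- fixed basis `b` need not be continuous in `x` separately. Their ratio does not depend on the
  -- vectors used, so it may be computed on the frame of the chart at `p`.
  have h := top_forms_proportional b (θ.onModel x).toAlternatingMap
    (conjPullback (θ'.onModel (f x)) (L x) (hL x)) (fun k => chartSymmDeriv (E := E) p x (b k))
  rw [mul_comm]
  exact h

/-- A conjugate-linear isomorphism of the tangent bundle over `f` reverses the canonical class. -/
theorem cechPullback_eq_neg_of_conjLinear [FiniteDimensional ℂ E] (f : C(M, M)) (L : M → E →L[ℝ] E)
    (hL : ∀ x v, L x (Complex.I • v) = -(Complex.I • L x v))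
    (hsurj : ∀ x, Function.Surjective (L x))
    (hcont : ∀ p, ContinuousAt (fun x => (chartDeriv (E := E) (f p) (f x)).comp
      ((L x).comp (chartSymmDeriv p x))) p)
    {κ : CechH2 M} (hκ : IsCanonicalClass E κ) : cechPullback f κ = -κ := by
  obtain ⟨U, θ, l, c, hθ, hl, hθl, hc, rfl⟩ := hκ
  let b := Module.finBasis ℂ E
  let P : ∀ i x, E [⋀^Fin (Module.finrank ℂ E)]→ₗ[ℂ] ℂ := fun i x =>
    conjPullback ((θ (f i)).onModel (f x)) (L x) (hL x)
  have hP0 (i x) (hx : f x ∈ U.set (f i)) : P i x b ≠ 0 := by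
    refine (AlternatingMap.map_basis_ne_zero_iff b _).2 fun h0 => (hθ (f i)).ne_zero _ hx ?_
    refine ContinuousAlternatingMap.ext fun v => ?_
    choose w hw using fun k => hsurj x (v k)
    have h1 := congrArg conj (DFunLike.congr_fun h0 w)
    simp only [P, conjPullback, AlternatingMap.coe_mk, MultilinearMap.coe_mk, hw,
      AlternatingMap.zero_apply, map_zero, Complex.conj_conj] at h1
    exact h1
  have hloc (i : M) : ∃ W : Set M, IsOpen W ∧ i ∈ W ∧
      W ⊆ U.set i ∩ f ⁻¹' U.set (f i) ∧ ∃ m : M → ℂ, ContinuousOn m W ∧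
      ∀ x ∈ W, P i x b / (θ i).onModel x b = Complex.exp (2 * Real.pi * Complex.I * m x) := by
    have ho : IsOpen (U.set i ∩ f ⁻¹' U.set (f i)) :=
      (U.isOpen_set i).inter ((U.isOpen_set (f i)).preimage f.continuous)
    refine exists_continuousOn_exp_two_pi_I (ho.mem_nhds ⟨U.mem_set i, U.mem_set (f i)⟩)
      (fun x hx => ?_) ?_
    · exact continuousAt_conjPullback_div b hL (hθ i) (U.isOpen_set i) (hθ (f i))
        (U.isOpen_set (f i)) f.continuous.continuousAt hx.1 hx.2 (hcont x)
    · exact div_ne_zero (hP0 i i (U.mem_set (f i)))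
        (alternating_apply_basis_ne_zero b ((hθ i).ne_zero i (U.mem_set i)))
  choose W hWo hWi hWU m hm hmP using hloc
  let V : PointedCover M := ⟨W, hWo, hWi⟩
  -- On `W i` the conjugated pull-back of the frame `θ (f i)` is `exp (2πi m i) θ i`. Comparing this
  -- over `W i ∩ W j` with both transition functions shows that `exp (2πi g) = 1`. The terms in `m`
  -- cancel in the coboundary of `g`, which is therefore `c + f^*c`.
  let g : M → M → M → ℂ := fun i j x =>
    l i j x + conj (l (f i) (f j) (f x)) + m j x - m i x
  have hint (i j x) (hx : x ∈ W i ∩ W j) : ∃ n : ℤ, g i j x = n := by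
    have hi := hWU i hx.1
    have hj := hWU j hx.2
    have h1 := hθl i j x ⟨hi.1, hj.1⟩
    have h2 := hθl (f i) (f j) (f x) ⟨hi.2, hj.2⟩
    have h1b : (θ j).onModel x b =
        Complex.exp (2 * Real.pi * Complex.I * l i j x) * (θ i).onModel x b :=
      DFunLike.congr_fun h1 (b : Fin _ → E)
    have h2b : P j x b =
        Complex.exp (2 * Real.pi * Complex.I * -conj (l (f i) (f j) (f x))) * P i x b := by
      have h3 := congrArg conj (DFunLike.congr_fun h2 (fun k => L x (b k)))
      refine h3.trans ?_
      rw [← conj_exp_two_pi_I]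
      exact map_mul _ _ _
    have hb : (θ i).onModel x b ≠ 0 :=
      alternating_apply_basis_ne_zero b ((hθ i).ne_zero x hi.1)
    have hmi := hmP i x hx.1
    have hmj := hmP j x hx.2
    rw [div_eq_iff hb] at hmi
    rw [h1b, div_eq_iff (mul_ne_zero (Complex.exp_ne_zero _) hb), h2b, hmi] at hmj
    have h4 : Complex.exp (2 * Real.pi * Complex.I * g i j x) = 1 := by
      have h5 : Complex.exp (2 * Real.pi * Complex.I * -conj (l (f i) (f j) (f x))) *
          Complex.exp (2 * Real.pi * Complex.I * m i x) =
          Complex.exp (2 * Real.pi * Complex.I * m j x) *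
          Complex.exp (2 * Real.pi * Complex.I * l i j x) := by
        apply mul_right_cancel₀ hb
        linear_combination hmj
      rw [← Complex.exp_add, ← Complex.exp_add] at h5
      rw [show 2 * Real.pi * Complex.I * g i j x =
        (2 * Real.pi * Complex.I * m j x + 2 * Real.pi * Complex.I * l i j x) -
        (2 * Real.pi * Complex.I * -conj (l (f i) (f j) (f x)) +
          2 * Real.pi * Complex.I * m i x) by simp only [g]; ring, Complex.exp_sub, h5]
      exact div_self (Complex.exp_ne_zero _)
    obtain ⟨n, hn⟩ := Complex.exp_eq_one_iff.1 h4
    refine ⟨n, mul_left_cancel₀ Complex.two_pi_I_ne_zero ?_⟩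
    rw [hn, mul_comm]
  have hg (i j) : ContinuousOn (g i j) (W i ∩ W j) := by
    have h1 : ContinuousOn (l i j) (W i ∩ W j) :=
      (hl i j).mono fun x hx => ⟨(hWU i hx.1).1, (hWU j hx.2).1⟩
    have h2 : ContinuousOn (fun x => l (f i) (f j) (f x)) (W i ∩ W j) :=
      (hl (f i) (f j)).comp f.continuous.continuousOn
        fun x hx => ⟨(hWU i hx.1).2, (hWU j hx.2).2⟩
    exact ((h1.add (Complex.continuous_conj.comp_continuousOn h2)).add
      ((hm j).mono Set.inter_subset_right)).sub ((hm i).mono Set.inter_subset_left)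
  have hround (i j x) (hx : x ∈ W i ∩ W j) : (((round (g i j x).re : ℤ) : ℚ) : ℂ) = g i j x := by
    obtain ⟨n, hn⟩ := hint i j x hx
    rw [hn]
    simp
  refine eq_neg_of_add_eq_zero_left ?_
  change ((cechPullbackCocycles f c : ↥(cechCocycles M)) : CechH2 M) + (c : CechH2 M) = 0
  rw [← QuotientAddGroup.mk_add, QuotientAddGroup.eq_zero_iff, AddSubgroup.mem_addSubgroupOf]
  refine ⟨V, fun i j x => ((round (g i j x).re : ℤ) : ℚ), fun i j =>
    locallyConstOn_round_re ((hWo i).inter (hWo j)) (hg i j) (hint i j), fun i j k x hx => ?_⟩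
  have hi : x ∈ W i := hx.1.1
  have hj : x ∈ W j := hx.1.2
  have hk : x ∈ W k := hx.2
  have h1 := hc i j k x ⟨⟨(hWU i hi).1, (hWU j hj).1⟩, (hWU k hk).1⟩
  have h2 := congrArg conj (hc (f i) (f j) (f k) (f x)
    ⟨⟨(hWU i hi).2, (hWU j hj).2⟩, (hWU k hk).2⟩)
  simp only [map_sub, map_add, map_ratCast] at h2
  change c.1 (f i) (f j) (f k) (f x) + c.1 i j k x = _
  have h3 : ((c.1 (f i) (f j) (f k) (f x) + c.1 i j k x : ℚ) : ℂ) =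
      (((round (g j k x).re : ℤ) - (round (g i k x).re : ℤ) + (round (g i j x).re : ℤ) : ℚ) : ℂ) := by
    rw [Rat.cast_add, Rat.cast_add, Rat.cast_sub, hround j k x ⟨hj, hk⟩, hround i k x ⟨hi, hk⟩,
      hround i j x ⟨hi, hj⟩, h1, h2]
    simp only [g]
    ring
  exact Rat.cast_injective h3

end CanonicalClass

/-! ### Paths of complex structures on the tangent bundle -/

section Paths

variable {E : Type*} [NormedAddCommGroup E] [NormedSpace ℝ E]
  {M : Type*} [TopologicalSpace M] [ChartedSpace E M]

/-- The field of operators `A x`, read in the chart at `p`. -/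
noncomputable def readInChart (p x : M) (A : E →L[ℝ] E) : E →L[ℝ] E :=
  (chartDeriv p x).comp (A.comp (chartSymmDeriv p x))

/-- Continuity of a family of operators on tangent spaces, along a map `π` to the base, tested in
the charts centred at the points considered. -/
def ContinuousOperators {Z : Type*} [TopologicalSpace Z] (π : Z → M) (A : Z → E →L[ℝ] E) : Prop :=
  ∀ z₀, ContinuousAt (fun z => readInChart (π z₀) (π z) (A z)) z₀

section ReadInChart

variable [IsManifold 𝓘(ℝ, E) 1 M]

lemma readInChart_mul {p x : M} (hx : x ∈ (chartAt E p).source) (A B : E →L[ℝ] E) :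
    readInChart p x (A * B) = readInChart p x A * readInChart p x B :=
  chart_comp_comp hx B A

lemma readInChart_one {p x : M} (hx : x ∈ (chartAt E p).source) :
    readInChart p x (1 : E →L[ℝ] E) = 1 := by
  ext v
  simp [readInChart, chartDeriv_chartSymmDeriv_apply hx]

lemma isUnit_of_readInChart {p x : M} (hx : x ∈ (chartAt E p).source) {A : E →L[ℝ] E}
    (h : IsUnit (readInChart p x A)) : IsUnit A := by
  have hST := chartSymmDeriv_comp_chartDeriv (E := E) hx
  have hTS := chartDeriv_comp_chartSymmDeriv (E := E) hx
  have hS : IsUnit (chartDeriv (E := E) p x) := ⟨⟨_, _, hTS, hST⟩, rfl⟩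
  have hT : IsUnit (chartSymmDeriv (E := E) p x) := ⟨⟨_, _, hST, hTS⟩, rfl⟩
  have hA : A = chartSymmDeriv p x * readInChart p x A * chartDeriv p x := by
    ext v
    simp [readInChart, chartSymmDeriv_chartDeriv_apply hx]
  rw [hA]
  exact (hT.mul h).mul hS

variable {Z : Type*} [TopologicalSpace Z] {π : Z → M}

lemma ContinuousOperators.mul (hπ : Continuous π) {A B : Z → E →L[ℝ] E}
    (hA : ContinuousOperators π A) (hB : ContinuousOperators π B) :
    ContinuousOperators π fun z => A z * B z := fun z₀ =>
  ((hA z₀).mul (hB z₀)).congr <| by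
    filter_upwards [hπ.continuousAt.eventually (eventually_mem_chart_source (E := E) (π z₀))]
      with z hz
    exact (readInChart_mul hz _ _).symm

lemma ContinuousOperators.one (hπ : Continuous π) :
    ContinuousOperators (E := E) π fun _ => 1 := fun z₀ =>
  (continuousAt_const (y := (1 : E →L[ℝ] E))).congr <| by
    filter_upwards [hπ.continuousAt.eventually (eventually_mem_chart_source (E := E) (π z₀))]
      with z hz
    exact (readInChart_one hz).symm

end ReadInChart

variable {Z : Type*} [TopologicalSpace Z] {π : Z → M}

lemma ContinuousOperators.sub {A B : Z → E →L[ℝ] E}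
    (hA : ContinuousOperators π A) (hB : ContinuousOperators π B) :
    ContinuousOperators π fun z => A z - B z := fun z₀ =>
  ((hA z₀).sub (hB z₀)).congr <| .of_forall fun z => by
    ext v; simp [readInChart]

lemma ContinuousOperators.const_smul {A : Z → E →L[ℝ] E} (c : ℝ)
    (hA : ContinuousOperators π A) : ContinuousOperators π fun z => c • A z := fun z₀ =>
  ((hA z₀).const_smul c).congr <| .of_forall fun z => by
    ext v; simp [readInChart]

lemma ContinuousOperators.comp {Z' : Type*} [TopologicalSpace Z'] {A : Z → E →L[ℝ] E}
    (hA : ContinuousOperators π A) {u : Z' → Z} (hu : Continuous u) :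
    ContinuousOperators (π ∘ u) (A ∘ u) := fun z₀ =>
  ContinuousAt.comp (f := u) (hA (u z₀)) hu.continuousAt

/-- Used for a product whose number of factors varies with the point but can be taken constant near
each point. -/
lemma ContinuousOperators.of_eventuallyEq {A : Z → E →L[ℝ] E}
    (h : ∀ z₀, ∃ B, ContinuousOperators π B ∧ A =ᶠ[𝓝 z₀] B) : ContinuousOperators π A := by
  intro z₀
  obtain ⟨B, hB, hAB⟩ := h z₀
  refine (hB z₀).congr ?_
  filter_upwards [hAB] with z hz
  rw [hz]

/-- The map `(1 - J' J) / 2`, which intertwines `J` and `J'`. -/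
noncomputable def intertwiner (J J' : E →L[ℝ] E) : E →L[ℝ] E := (2⁻¹ : ℝ) • (1 - J' * J)

/-- Both sides equal `(J + J') / 2`. -/
lemma intertwiner_mul {J J' : E →L[ℝ] E} (h : J * J = -1) (h' : J' * J' = -1) :
    intertwiner J J' * J = J' * intertwiner J J' := by
  rw [intertwiner, smul_mul_assoc, mul_smul_comm, sub_mul, mul_sub, mul_assoc, h, ← mul_assoc, h']
  simp [add_comm]

lemma intertwiner_self {J : E →L[ℝ] E} (h : J * J = -1) : intertwiner J J = 1 := by
  rw [intertwiner, h, sub_neg_eq_add, ← two_smul ℝ (1 : E →L[ℝ] E), smul_smul]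
  norm_num

variable [FiniteDimensional ℝ E] [IsManifold 𝓘(ℝ, E) 1 M]

/-- Units are open in the Banach algebra of operators on `E`, and invertibility can be tested in a
chart. -/
lemma ContinuousOperators.isUnit_eventually {A : Z → E →L[ℝ] E} (hπ : Continuous π)
    (hA : ContinuousOperators π A) {z₀ : Z} (h : IsUnit (readInChart (π z₀) (π z₀) (A z₀))) :
    ∀ᶠ z in 𝓝 z₀, IsUnit (A z) := by
  have : CompleteSpace E := FiniteDimensional.complete ℝ E
  filter_upwards [(hA z₀).eventually (Units.isOpen.mem_nhds h),
    hπ.continuousAt.eventually (eventually_mem_chart_source (E := E) (π z₀))] with z h1 h2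
  exact isUnit_of_readInChart h2 h1

/-- The end points of a path of complex structures on the tangent bundle are isomorphic. -/
theorem exists_intertwining_of_path [T2Space M] [SigmaCompactSpace M]
    (J : unitInterval → M → E →L[ℝ] E) (hJ : ∀ t x, J t x * J t x = -1)
    (hcont : ContinuousOperators Prod.snd fun q : unitInterval × M => J q.1 q.2) :
    ∃ Ψ : M → E →L[ℝ] E, ContinuousOperators id Ψ ∧ (∀ x, IsUnit (Ψ x)) ∧
      ∀ x, Ψ x * J 0 x = J 1 x * Ψ x := by
  have : LocallyCompactSpace M := ChartedSpace.locallyCompactSpace E M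
  let τ : ℝ → unitInterval := Set.projIcc 0 1 zero_le_one
  have hτ : Continuous τ := continuous_projIcc
  have hstep : ContinuousOperators (Prod.snd : (unitInterval × unitInterval) × M → M)
      fun q => intertwiner (J q.1.1 q.2) (J q.1.2 q.2) := by
    have h1 := hcont.comp (u := fun q : (unitInterval × unitInterval) × M => (q.1.1, q.2))
      (by fun_prop)
    have h2 := hcont.comp (u := fun q : (unitInterval × unitInterval) × M => (q.1.2, q.2))
      (by fun_prop)
    exact ((ContinuousOperators.one continuous_snd).sub (h2.mul continuous_snd h1)).const_smul _
  let good : ℝ → M → unitInterval → Prop := fun e x t =>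
    IsUnit (intertwiner (J t x) (J (τ (t + e)) x))
  -- At step length `0` the intertwiner is the identity. Compactness of the time interval makes
  -- invertibility for small steps uniform in `t`, locally in `x`.
  have hloc (x₀ : M) : ∀ᶠ q : M × ℝ in 𝓝 (x₀, 0), ∀ t : unitInterval, good q.2 q.1 t := by
    have h := IsCompact.eventually_forall_of_forall_eventually (x₀ := (x₀, (0 : ℝ)))
      (K := (Set.univ : Set unitInterval)) isCompact_univ
      (P := fun q t => good q.2 q.1 t) (fun t _ => ?_)
    · simpa using h
    · have hu : Continuous fun q : (M × ℝ) × unitInterval =>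
          ((q.2, τ (q.2 + q.1.2)), q.1.1) := by fun_prop
      refine (hstep.comp hu).isUnit_eventually (by fun_prop) (z₀ := ((x₀, 0), t)) ?_
      have ht : τ ((t : ℝ) + 0) = t := by simp [τ]
      simp only [Function.comp_apply, ht, intertwiner_self (hJ _ _)]
      rw [readInChart_one (mem_chart_source E x₀)]
      exact isUnit_one
  -- Admissible step lengths are closed under decrease within the positive reals, so they form a
  -- convex set. Locally constant choices can then be glued to a continuous positive step length
  -- `ε`.
  let S : M → Set ℝ := fun x => {e | 0 < e ∧ ∀ e' ∈ Set.Icc 0 e, ∀ t, good e' x t}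
  obtain ⟨ε, hε⟩ : ∃ ε : C(M, ℝ), ∀ x, ε x ∈ S x := by
    refine exists_continuous_forall_mem_convex_of_local_const (fun x => ?_) fun x₀ => ?_
    · have : (S x).OrdConnected := ⟨fun a ha b hb c hc =>
        ⟨ha.1.trans_le hc.1, fun e' he' => hb.2 e' ⟨he'.1, he'.2.trans hc.2⟩⟩⟩
      exact this.convex
    · obtain ⟨pa, hpa, pb, hpb, h⟩ := Filter.eventually_prod_iff.1 ((nhds_prod_eq (x := x₀)
        (y := (0 : ℝ))) ▸ hloc x₀)
      obtain ⟨r, hr, hrb⟩ := Metric.eventually_nhds_iff.1 hpb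
      refine ⟨r / 2, ?_⟩
      filter_upwards [hpa] with x hx
      refine ⟨by positivity, fun e' he' => h hx (hrb ?_)⟩
      rw [Real.dist_eq, sub_zero, abs_of_nonneg he'.1]
      linarith [he'.2]
  let s : ℕ → M → unitInterval := fun k x => τ (k * ε x)
  have hs (k : ℕ) : Continuous (s k) := by fun_prop
  have hs0 (x : M) : s 0 x = 0 := by simp [s, τ]
  -- Truncating at time `1` before or after adding the positive step gives the same result.
  have hs_succ (k : ℕ) (x : M) : s (k + 1) x = τ (s k x + ε x) := by
    have h0 := (hε x).1
    have hk : 0 ≤ (k : ℝ) * ε x := by positivity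
    apply Subtype.ext
    simp only [s, τ, Set.coe_projIcc]
    push_cast
    rw [max_eq_right (le_min zero_le_one hk), add_mul, one_mul]
    congr 1
    rcases le_total 1 ((k : ℝ) * ε x) with h | h
    · rw [min_eq_left h, min_eq_left (by linarith), min_eq_left (by linarith)]
    · rw [min_eq_right h]
  have hs_one (k : ℕ) (x : M) (h : 1 ≤ k * ε x) : s k x = 1 := by
    simp only [s, τ, Set.projIcc_of_right_le _ h]
    rfl
  let Ψ : ℕ → M → E →L[ℝ] E := fun k x => Nat.rec 1
    (fun i A => intertwiner (J (s i x) x) (J (s (i + 1) x) x) * A) k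
  have hΨ_succ (k : ℕ) (x : M) : Ψ (k + 1) x =
      intertwiner (J (s k x) x) (J (s (k + 1) x) x) * Ψ k x := rfl
  have hΨ_cont (k : ℕ) : ContinuousOperators id (Ψ k) := by
    induction k with
    | zero => exact ContinuousOperators.one continuous_id
    | succ k ih =>
      have h := hstep.comp (u := fun x => ((s k x, s (k + 1) x), x))
        (((hs k).prodMk (hs (k + 1))).prodMk continuous_id)
      exact ContinuousOperators.mul continuous_id h ih
  have hΨ_unit (k : ℕ) (x : M) : IsUnit (Ψ k x) := by
    induction k with
    | zero => exact isUnit_one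
    | succ k ih =>
      rw [hΨ_succ]
      refine IsUnit.mul ?_ ih
      rw [hs_succ]
      exact (hε x).2 (ε x) ⟨(hε x).1.le, le_rfl⟩ (s k x)
  have hΨ_comm (k : ℕ) (x : M) : Ψ k x * J 0 x = J (s k x) x * Ψ k x := by
    induction k with
    | zero => rw [hs0]; exact (one_mul _).trans (mul_one _).symm
    | succ k ih =>
      rw [hΨ_succ, mul_assoc, ih, ← mul_assoc, intertwiner_mul (hJ _ _) (hJ _ _), mul_assoc]
  -- Once time `1` is reached, every further factor is the intertwiner of `J 1 x` with itself, which
  -- is `1`.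
  have hΨ_stable (k j : ℕ) (x : M) (h : 1 ≤ k * ε x) : Ψ (k + j) x = Ψ k x := by
    induction j with
    | zero => rfl
    | succ j ih =>
      have h0 := (hε x).1
      have h1 : 1 ≤ ((k + j : ℕ) : ℝ) * ε x := h.trans (by push_cast; gcongr; simp)
      have h2 : 1 ≤ ((k + j + 1 : ℕ) : ℝ) * ε x := by
        push_cast at h1 ⊢
        linarith
      rw [← add_assoc, hΨ_succ, hs_one _ _ h1, hs_one _ _ h2, intertwiner_self (hJ _ _), one_mul, ih]
  let N : M → ℕ := fun x => ⌈(ε x)⁻¹⌉₊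
  have hN (x : M) (k : ℕ) (h : (ε x)⁻¹ ≤ k) : 1 ≤ k * ε x := by
    rwa [inv_le_iff_one_le_mul₀ (hε x).1] at h
  refine ⟨fun x => Ψ (N x) x, ?_, fun x => hΨ_unit _ x, fun x => ?_⟩
  · refine ContinuousOperators.of_eventuallyEq fun x₀ => ?_
    -- Near `x₀` the fixed number `K` of factors suffices, so the product agrees there with the
    -- continuous family `Ψ K`.
    obtain ⟨K, hK⟩ := exists_nat_gt (ε x₀)⁻¹
    refine ⟨Ψ K, hΨ_cont K, ?_⟩
    have hc : ContinuousAt (fun x => (ε x)⁻¹) x₀ := ε.continuous.continuousAt.inv₀ (hε x₀).1.ne'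
    filter_upwards [hc.eventually (gt_mem_nhds hK)] with x hx
    obtain ⟨j, hj⟩ := Nat.exists_eq_add_of_le (Nat.ceil_le.2 hx.le : N x ≤ K)
    rw [hj]
    exact (hΨ_stable (N x) j x (hN x _ (Nat.le_ceil _))).symm
  · rw [hΨ_comm, hs_one _ _ (hN x _ (Nat.le_ceil _))]

end Paths

/-! ### The complex structure of an invertible skew operator -/

section Polar

/-- This is `∫ ds / (s² + a)` over `(0, ∞)`: the substitution `s ↦ 1/s` carries the part over `[1,
∞)` to the second summand on `(0, 1]`. The compact interval avoids improper integrals of operators.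
-/
lemma integral_polar_kernel {a : ℝ} (ha : 0 < a) :
    ∫ s in (0 : ℝ)..1, ((s ^ 2 + a)⁻¹ + (1 + s ^ 2 * a)⁻¹) = Real.pi / 2 * (√a)⁻¹ := by
  have hs : 0 < √a := Real.sqrt_pos.2 ha
  have hsq : √a ^ 2 = a := Real.sq_sqrt ha.le
  have hderiv (s : ℝ) (_ : s ∈ Set.uIcc (0 : ℝ) 1) : HasDerivAt
      (fun s => (√a)⁻¹ * (Real.arctan (s * (√a)⁻¹) + Real.arctan (s * √a)))
      ((s ^ 2 + a)⁻¹ + (1 + s ^ 2 * a)⁻¹) s := by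
    have h1 := ((hasDerivAt_id s).mul_const (√a)⁻¹).arctan
    have h2 := ((hasDerivAt_id s).mul_const (√a)).arctan
    refine ((h1.add h2).const_mul (√a)⁻¹).congr_deriv ?_
    have h3 : 0 < s ^ 2 + a := by positivity
    have h4 : 0 < 1 + s ^ 2 * a := by positivity
    simp only [id, mul_pow, inv_pow, hsq]
    field_simp
    rw [hsq]
    field_simp
    ring
  have hcont : Continuous fun s : ℝ => (s ^ 2 + a)⁻¹ + (1 + s ^ 2 * a)⁻¹ := by
    refine Continuous.add (Continuous.inv₀ (by fun_prop) fun s => ?_)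
      (Continuous.inv₀ (by fun_prop) fun s => ?_) <;> positivity
  rw [intervalIntegral.integral_eq_sub_of_hasDerivAt hderiv (hcont.intervalIntegrable _ _)]
  simp only [one_mul, zero_mul, Real.arctan_zero, add_zero, mul_zero, sub_zero,
    Real.arctan_inv_of_pos hs]
  ring

/-- Over the reals, an operator that is symmetric for a positive definite form is
diagonalizable. -/
lemma iSup_eigenspace_eq_top_of_symmetric {V : Type*} [AddCommGroup V] [Module ℝ V]
    [FiniteDimensional ℝ V] (g : V →ₗ[ℝ] V →ₗ[ℝ] ℝ) (hsymm : ∀ v w, g v w = g w v)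
    (hpos : ∀ v, v ≠ 0 → 0 < g v v) (S : V →ₗ[ℝ] V) (hS : ∀ v w, g (S v) w = g v (S w)) :
    ⨆ μ : ℝ, Module.End.eigenspace S μ = ⊤ := by
  -- With `g` as the inner product, this is the spectral theorem for `S`.
  let core : InnerProductSpace.Core ℝ V :=
    { inner := fun v w => g v w
      conj_inner_symm := fun v w => hsymm w v
      re_inner_nonneg := fun v => by
        by_cases h : v = 0
        · simp [h]
        · exact (hpos v h).le
      add_left := fun u v w => by simp
      smul_left := fun u v r => by simp
      definite := fun v hv => by
        by_contra h
        exact (hpos v h).ne' hv }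
  let _ : NormedAddCommGroup V := core.toNormedAddCommGroup
  let _ : InnerProductSpace ℝ V := InnerProductSpace.ofCore core.toCore
  have hsym : S.IsSymmetric := fun v w => hS v w
  rw [← Submodule.orthogonal_eq_bot_iff]
  exact hsym.orthogonalComplement_iSup_eigenspaces_eq_bot

variable {E : Type*} [NormedAddCommGroup E] [NormedSpace ℝ E]

/-- `A` times the inverse square root of `-A²`, as an integral of resolvents of `A²`. -/
noncomputable def polarPart (A : E →L[ℝ] E) : E →L[ℝ] E :=
  (2 / Real.pi) • (A * ∫ s in (0 : ℝ)..1,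
    (Ring.inverse (s ^ 2 • (1 : E →L[ℝ] E) - A * A) + Ring.inverse (1 - s ^ 2 • (A * A))))

/-- The resolvents in the definition of `polarPart A` exist. -/
def HasPolarPart (A : E →L[ℝ] E) : Prop :=
  ∀ s : ℝ, IsUnit (s ^ 2 • (1 : E →L[ℝ] E) - A * A) ∧ IsUnit (1 - s ^ 2 • (A * A))

lemma conj_mul_conj {S T : E →L[ℝ] E} (hTS : T * S = 1) (B C : E →L[ℝ] E) : S * B * T * (S * C * T) = S * (B * C) * T := by
  calc S * B * T * (S * C * T) = S * B * (T * S) * C * T := by noncomm_ring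
    _ = _ := by rw [hTS]; noncomm_ring

section Conjugation

variable {A S T : E →L[ℝ] E} (hST : S * T = 1) (hTS : T * S = 1)

include hST hTS

lemma ring_inverse_conj (B : E →L[ℝ] E) : Ring.inverse (S * B * T) = S * Ring.inverse B * T := by
  have hS : IsUnit S := ⟨⟨S, T, hST, hTS⟩, rfl⟩
  have hT : IsUnit T := ⟨⟨T, S, hTS, hST⟩, rfl⟩
  by_cases hB : IsUnit B
  · have hu : IsUnit (S * B * T) := (hS.mul hB).mul hT
    rw [← hu.mul_right_inj, Ring.mul_inverse_cancel _ hu]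
    calc (1 : E →L[ℝ] E) = S * (B * Ring.inverse B) * T := by
          rw [Ring.mul_inverse_cancel _ hB, mul_one, hST]
      _ = S * B * (T * S) * Ring.inverse B * T := by rw [hTS, mul_one]; noncomm_ring
      _ = _ := by noncomm_ring
  -- For a non-unit both sides vanish, by the default value of `Ring.inverse`.
  · have hu : ¬ IsUnit (S * B * T) := fun h => hB <| by
      have : B = T * (S * B * T) * S := by
        calc B = (T * S) * B * (T * S) := by rw [hTS, one_mul, mul_one]
          _ = _ := by noncomm_ring
      rw [this]
      exact (hT.mul h).mul hS
    rw [Ring.inverse_non_unit _ hu, Ring.inverse_non_unit _ hB, mul_zero, zero_mul]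

lemma smul_one_sub_conj (s : ℝ) :
    s • (1 : E →L[ℝ] E) - S * A * T * (S * A * T) = S * (s • (1 : E →L[ℝ] E) - A * A) * T := by
  rw [conj_mul_conj hTS, mul_sub, sub_mul, mul_smul_comm, smul_mul_assoc, mul_one, hST]

lemma one_sub_smul_conj (s : ℝ) :
    1 - s • (S * A * T * (S * A * T)) = S * (1 - s • (A * A)) * T := by
  rw [conj_mul_conj hTS, mul_sub, sub_mul, mul_smul_comm, smul_mul_assoc, mul_one, hST]

lemma HasPolarPart.conj (hA : HasPolarPart A) : HasPolarPart (S * A * T) := fun s => by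
  have hS : IsUnit S := ⟨⟨S, T, hST, hTS⟩, rfl⟩
  have hT : IsUnit T := ⟨⟨T, S, hTS, hST⟩, rfl⟩
  rw [smul_one_sub_conj hST hTS, one_sub_smul_conj hST hTS]
  exact ⟨(hS.mul (hA s).1).mul hT, (hS.mul (hA s).2).mul hT⟩

end Conjugation

lemma apply_ring_inverse_of_smul {B : E →L[ℝ] E} (hB : IsUnit B) {v : E} {a : ℝ} (ha : a ≠ 0)
    (h : B v = a • v) : Ring.inverse B v = a⁻¹ • v := by
  have h1 : v = B (a⁻¹ • v) := by rw [map_smul, h, smul_smul, inv_mul_cancel₀ ha, one_smul]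
  conv_lhs => rw [h1]
  exact DFunLike.congr_fun (Ring.inverse_mul_cancel _ hB) (a⁻¹ • v)

lemma hasPolarPart_of_sq {A : E →L[ℝ] E} (hA : A * A = -1) : HasPolarPart A := fun s => by
  have h : 0 < s ^ 2 + 1 := by positivity
  have h1 : s ^ 2 • (1 : E →L[ℝ] E) - A * A = algebraMap ℝ _ (s ^ 2 + 1) := by
    rw [hA, sub_neg_eq_add, Algebra.algebraMap_eq_smul_one, add_smul, one_smul]
  have h2 : 1 - s ^ 2 • (A * A) = algebraMap ℝ _ (s ^ 2 + 1) := by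
    rw [hA, smul_neg, sub_neg_eq_add, Algebra.algebraMap_eq_smul_one, add_smul, one_smul, add_comm]
  rw [h1, h2]
  exact ⟨(IsUnit.mk0 _ h.ne').map _, (IsUnit.mk0 _ h.ne').map _⟩

variable [FiniteDimensional ℝ E]

lemma continuous_resolvents : Continuous fun q : {A : E →L[ℝ] E // HasPolarPart A} × ℝ =>
    Ring.inverse (q.2 ^ 2 • (1 : E →L[ℝ] E) - q.1.1 * q.1.1) +
      Ring.inverse (1 - q.2 ^ 2 • (q.1.1 * q.1.1)) := by
  have : CompleteSpace E := FiniteDimensional.complete ℝ E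
  refine continuous_iff_continuousAt.2 fun q => ContinuousAt.add ?_ ?_
  · obtain ⟨u, hu⟩ := (q.1.2 q.2).1
    have h := NormedRing.inverse_continuousAt u
    rw [hu] at h
    exact ContinuousAt.comp (f := fun q : {A : E →L[ℝ] E // HasPolarPart A} × ℝ =>
      q.2 ^ 2 • (1 : E →L[ℝ] E) - q.1.1 * q.1.1) h (Continuous.continuousAt (by fun_prop))
  · obtain ⟨u, hu⟩ := (q.1.2 q.2).2
    have h := NormedRing.inverse_continuousAt u
    rw [hu] at h
    exact ContinuousAt.comp (f := fun q : {A : E →L[ℝ] E // HasPolarPart A} × ℝ =>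
      1 - q.2 ^ 2 • (q.1.1 * q.1.1)) h (Continuous.continuousAt (by fun_prop))

/-- An integral over a compact interval of a jointly continuous integrand depends continuously on
the parameter. -/
lemma continuousOn_polarPart : ContinuousOn (polarPart (E := E)) {A | HasPolarPart A} := by
  rw [continuousOn_iff_continuous_domRestrict]
  have h := intervalIntegral.continuous_parametric_intervalIntegral_of_continuous'
    (μ := MeasureTheory.volume) (f := fun (A : {A : E →L[ℝ] E // HasPolarPart A}) (s : ℝ) =>
      Ring.inverse (s ^ 2 • (1 : E →L[ℝ] E) - A.1 * A.1) +
      Ring.inverse (1 - s ^ 2 • (A.1 * A.1))) continuous_resolvents 0 1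
  exact (continuous_subtype_val.mul h).const_smul (2 / Real.pi)

lemma HasPolarPart.intervalIntegrable {A : E →L[ℝ] E} (hA : HasPolarPart A) :
    IntervalIntegrable (fun s : ℝ => Ring.inverse (s ^ 2 • (1 : E →L[ℝ] E) - A * A) +
      Ring.inverse (1 - s ^ 2 • (A * A))) MeasureTheory.volume 0 1 :=
  (continuous_resolvents.comp (Continuous.prodMk_right
    (⟨A, hA⟩ : {A : E →L[ℝ] E // HasPolarPart A}))).intervalIntegrable _ _

/-- Conjugation is a continuous linear map on operators, so it commutes with the integral. Thus the
polar part may be formed in any chart. -/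
lemma polarPart_conj {A S T : E →L[ℝ] E} (hA : HasPolarPart A) (hST : S * T = 1)
    (hTS : T * S = 1) : polarPart (S * A * T) = S * polarPart A * T := by
  have : CompleteSpace E := FiniteDimensional.complete ℝ E
  have h := ((ContinuousLinearMap.mul ℝ (E →L[ℝ] E) S).comp
    ((ContinuousLinearMap.mul ℝ (E →L[ℝ] E)).flip T)).intervalIntegral_comp_comm
      hA.intervalIntegrable
  simp only [ContinuousLinearMap.comp_apply, ContinuousLinearMap.flip_apply,
    ContinuousLinearMap.mul_apply'] at h
  have h2 : ∀ s : ℝ, Ring.inverse (s ^ 2 • (1 : E →L[ℝ] E) - S * A * T * (S * A * T)) +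
      Ring.inverse (1 - s ^ 2 • (S * A * T * (S * A * T))) =
      S * ((Ring.inverse (s ^ 2 • (1 : E →L[ℝ] E) - A * A) +
      Ring.inverse (1 - s ^ 2 • (A * A))) * T) := fun s => by
    rw [smul_one_sub_conj hST hTS, one_sub_smul_conj hST hTS, ring_inverse_conj hST hTS,
      ring_inverse_conj hST hTS]
    noncomm_ring
  rw [polarPart, polarPart]
  simp only [h2]
  rw [h, ← mul_assoc S, conj_mul_conj hTS, mul_smul_comm, smul_mul_assoc]

lemma polarPart_apply_of_eigenvector {A : E →L[ℝ] E} (hA : HasPolarPart A) {v : E} {a : ℝ}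
    (ha : 0 < a) (hv : A (A v) = -(a • v)) : polarPart A v = (√a)⁻¹ • A v := by
  have : CompleteSpace E := FiniteDimensional.complete ℝ E
  have h (s : ℝ) : (Ring.inverse (s ^ 2 • (1 : E →L[ℝ] E) - A * A) +
      Ring.inverse (1 - s ^ 2 • (A * A))) v = ((s ^ 2 + a)⁻¹ + (1 + s ^ 2 * a)⁻¹) • v := by
    rw [add_apply, add_smul]
    congr 1
    · refine apply_ring_inverse_of_smul (hA s).1 (by positivity) ?_
      simp [hv, add_smul]
    · refine apply_ring_inverse_of_smul (hA s).2 (by positivity) ?_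
      simp [hv, add_smul, mul_smul]
  rw [polarPart, smul_apply, mul_apply_eq_comp,
    ContinuousLinearMap.intervalIntegral_apply hA.intervalIntegrable]
  simp only [h]
  rw [intervalIntegral.integral_smul_const, integral_polar_kernel ha, map_smul, smul_smul,
    ← mul_assoc]
  congr 1
  field_simp

/-- Every vector is an eigenvector of `A²` with eigenvalue `-1`. This keeps the ends of the path of
complex structures in place. -/
lemma polarPart_of_sq {A : E →L[ℝ] E} (hA : A * A = -1) : polarPart A = A := by
  ext v
  rw [polarPart_apply_of_eigenvector (hasPolarPart_of_sq hA) one_pos]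
  · simp
  · rw [one_smul]
    exact DFunLike.congr_fun hA v

/-- A symmetric positive definite bilinear form. -/
structure IsInnerForm (g : E →L[ℝ] E →L[ℝ] ℝ) : Prop where
  symm : ∀ v w, g v w = g w v
  pos : ∀ v, v ≠ 0 → 0 < g v v

lemma IsInnerForm.nonneg {E : Type*} [NormedAddCommGroup E] [NormedSpace ℝ E]
    {g : E →L[ℝ] E →L[ℝ] ℝ} (hg : IsInnerForm g) (v : E) : 0 ≤ g v v := by
  by_cases h : v = 0
  · simp [h]
  · exact (hg.pos v h).le

/-! ### Polar parts of invertible skew operators -/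

section Skew

variable {g : E →L[ℝ] E →L[ℝ] ℝ} (hg : IsInnerForm g) {A : E →L[ℝ] E}
  (hA : ∀ v w, g (A v) w = -g v (A w)) (hinj : ∀ v, A v = 0 → v = 0)

include hg hA hinj

/-- The operator `-A²` is positive definite for `g`, hence so are both operators to be inverted;
positive definite operators are injective, and `E` is finite-dimensional. -/
lemma hasPolarPart_of_skew : HasPolarPart A := by
  have key (B : E →L[ℝ] E) (hB : ∀ v, v ≠ 0 → 0 < g (B v) v) : IsUnit B := by
    rw [ContinuousLinearMap.isUnit_iff_bijective]
    have hi : Function.Injective B := by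
      refine (injective_iff_map_eq_zero B).2 fun v hv => ?_
      by_contra h
      have := hB v h
      simp [hv] at this
    exact ⟨hi, (LinearMap.injective_iff_surjective (f := (B : E →ₗ[ℝ] E))).1 hi⟩
  have hneg (v : E) (hv : v ≠ 0) : g (A (A v)) v < 0 := by
    rw [hA, neg_lt_zero]
    exact hg.pos _ fun h => hv (hinj v h)
  intro s
  refine ⟨key _ fun v hv => ?_, key _ fun v hv => ?_⟩
  · have h1 := hneg v hv
    have h2 := mul_nonneg (sq_nonneg s) (hg.nonneg v)
    simp
    linarith
  · have h1 := mul_nonneg (sq_nonneg s) (neg_nonneg.2 (hneg v hv).le)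
    have h2 := hg.pos v hv
    simp
    linarith

/-- The operator `A²` is `g`-symmetric, hence diagonalizable, with negative eigenvalues `μ`. On the
`μ`-eigenspace, which `A` preserves, the polar part is `A / √(-μ)`, with square `A² / (-μ) = -1`. -/
lemma polarPart_sq_of_skew : polarPart A * polarPart A = -1 := by
  have hpol := hasPolarPart_of_skew hg hA hinj
  have htop := iSup_eigenspace_eq_top_of_symmetric
    ((ContinuousLinearMap.coeLM ℝ).comp (g : E →ₗ[ℝ] E →L[ℝ] ℝ)) hg.symm hg.pos
    ((A * A : E →L[ℝ] E) : E →ₗ[ℝ] E) (fun v w => by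
      change g (A (A v)) w = g v (A (A w))
      rw [hA, hA, neg_neg])
  have hmem (v : E) : v ∈ ⨆ μ : ℝ,
      Module.End.eigenspace ((A * A : E →L[ℝ] E) : E →ₗ[ℝ] E) μ := htop ▸ Submodule.mem_top
  ext v
  refine Submodule.iSup_induction _ (motive := fun v => (polarPart A * polarPart A) v =
    (-1 : E →L[ℝ] E) v) (hmem v) (fun μ v hv => ?_) (by simp) fun v w hv hw => by
      rw [map_add, hv, hw, map_add]
  have hv' : A (A v) = μ • v := Module.End.mem_eigenspace_iff.1 hv
  by_cases h0 : v = 0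
  · simp [h0]
  have hμ : 0 < -μ := by
    have h1 : 0 < g (A v) (A v) := hg.pos _ fun h => h0 (hinj v h)
    have h2 := hA (A v) v
    rw [hv', map_smul, smul_apply, smul_eq_mul] at h2
    have h3 := hg.pos v h0
    by_contra hcon
    nlinarith
  have h1 : A (A v) = -((-μ) • v) := by rw [hv', neg_smul, neg_neg]
  have h2 : A (A (A v)) = -((-μ) • A v) := by rw [h1, map_neg, map_smul]
  have h3 : (√(-μ))⁻¹ * (√(-μ))⁻¹ * (-μ) = 1 := by
    have h4 := Real.mul_self_sqrt hμ.le
    have h5 := (Real.sqrt_pos.2 hμ).ne'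
    rw [← mul_inv, h4, inv_mul_cancel₀ hμ.ne']
  rw [mul_apply_eq_comp, polarPart_apply_of_eigenvector hpol hμ h1, map_smul,
    polarPart_apply_of_eigenvector hpol hμ h2, h1, smul_neg, smul_neg, smul_smul, smul_smul,
    h3, one_smul]
  simp

end Skew

/-- The operator `A` with `g (A v) w = Ω v w`. -/
noncomputable def representingOperator (g Ω : E →L[ℝ] E →L[ℝ] ℝ) : E →L[ℝ] E :=
  g.inverse.comp Ω

/-- The isomorphism with the dual space given by an inner form. -/
lemma IsInnerForm.exists_equiv {g : E →L[ℝ] E →L[ℝ] ℝ} (hg : IsInnerForm g) :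
    ∃ e : E ≃L[ℝ] (E →L[ℝ] ℝ), (e : E →L[ℝ] E →L[ℝ] ℝ) = g := by
  have hi : Function.Injective (g : E →ₗ[ℝ] E →L[ℝ] ℝ) := by
    refine (injective_iff_map_eq_zero _).2 fun v hv => ?_
    by_contra h
    have h1 := hg.pos v h
    have h2 : g v v = 0 := DFunLike.congr_fun hv v
    exact h1.ne' h2
  have hdim : Module.finrank ℝ E = Module.finrank ℝ (E →L[ℝ] ℝ) := by
    rw [← Subspace.dual_finrank_eq]
    exact (LinearMap.toContinuousLinearMap (𝕜 := ℝ) (E := E) (F' := ℝ)).finrank_eq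
  exact ⟨(LinearEquiv.ofInjectiveOfFinrankEq _ hi hdim).toContinuousLinearEquiv, rfl⟩

lemma apply_representingOperator {g : E →L[ℝ] E →L[ℝ] ℝ} (hg : IsInnerForm g)
    (Ω : E →L[ℝ] E →L[ℝ] ℝ) (v w : E) : g (representingOperator g Ω v) w = Ω v w := by
  obtain ⟨e, rfl⟩ := hg.exists_equiv
  simp [representingOperator]

lemma eq_representingOperator {g Ω : E →L[ℝ] E →L[ℝ] ℝ} (hg : IsInnerForm g) {A : E →L[ℝ] E}
    (h : ∀ v w, g (A v) w = Ω v w) : A = representingOperator g Ω := by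
  obtain ⟨e, rfl⟩ := hg.exists_equiv
  ext v
  apply e.injective
  ext w
  have h1 := apply_representingOperator hg Ω v w
  rw [← h] at h1
  exact h1.symm

/-- Inversion of operators is continuous at an invertible one, and an inner form is invertible as a
map to the dual. -/
lemma continuousAt_representingOperator {Z : Type*} [TopologicalSpace Z]
    {g Ω : Z → E →L[ℝ] E →L[ℝ] ℝ} {z : Z} (hz : IsInnerForm (g z)) (hg : ContinuousAt g z)
    (hΩ : ContinuousAt Ω z) : ContinuousAt (fun z => representingOperator (g z) (Ω z)) z := by
  have : CompleteSpace E := FiniteDimensional.complete ℝ E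
  obtain ⟨e, he⟩ := hz.exists_equiv
  have h := (contDiffAt_map_inverse (n := 0) e).continuousAt
  rw [he] at h
  exact (ContinuousAt.comp (f := g) h hg).clm_comp hΩ

end Polar

/-! ### Symplectic forms -/

section Bilinear

variable {E : Type*} [NormedAddCommGroup E] [NormedSpace ℝ E]

lemma IsInnerForm.bilinearComp {g : E →L[ℝ] E →L[ℝ] ℝ} (hg : IsInnerForm g) {T : E →L[ℝ] E}
    (hT : Function.Injective T) : IsInnerForm (g.bilinearComp T T) where
  symm _ _ := hg.symm _ _
  pos _ hv := hg.pos _ fun h => hv (hT (h.trans (map_zero T).symm))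

lemma IsInnerForm.segment {g g' : E →L[ℝ] E →L[ℝ] ℝ} (hg : IsInnerForm g) (hg' : IsInnerForm g')
    (t : unitInterval) : IsInnerForm ((1 - (t : ℝ)) • g + (t : ℝ) • g') where
  symm v w := by simp [hg.symm v w, hg'.symm v w]
  pos v hv := by
    have h1 := hg.pos v hv
    have h2 := hg'.pos v hv
    simp only [add_apply, smul_apply, smul_eq_mul]
    rcases t.2.1.eq_or_lt with h | h
    · rw [← h]; simpa using h1
    · have := mul_nonneg (sub_nonneg.2 t.2.2) h1.le
      have := mul_pos h h2
      linarith

variable {M : Type*} [TopologicalSpace M] [ChartedSpace E M]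

/-- Continuity of a family of bilinear forms on tangent spaces, along a map `π` to the base, tested
in the charts centred at the points considered. -/
def ContinuousBilinear {Z : Type*} [TopologicalSpace Z] (π : Z → M)
    (B : Z → E →L[ℝ] E →L[ℝ] ℝ) : Prop :=
  ∀ z₀, ContinuousAt (fun z => (B z).bilinearComp (chartSymmDeriv (π z₀) (π z))
    (chartSymmDeriv (π z₀) (π z))) z₀

variable {Z : Type*} [TopologicalSpace Z] {π : Z → M}

lemma ContinuousBilinear.comp {Z' : Type*} [TopologicalSpace Z'] {B : Z → E →L[ℝ] E →L[ℝ] ℝ}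
    (hB : ContinuousBilinear π B) {u : Z' → Z} (hu : Continuous u) :
    ContinuousBilinear (π ∘ u) (B ∘ u) := fun z₀ =>
  ContinuousAt.comp (f := u) (hB (u z₀)) hu.continuousAt

lemma ContinuousBilinear.segment {B B' : Z → E →L[ℝ] E →L[ℝ] ℝ}
    (hB : ContinuousBilinear π B) (hB' : ContinuousBilinear π B') {t : Z → ℝ}
    (ht : Continuous t) :
    ContinuousBilinear π fun z => (1 - t z) • B z + t z • B' z := fun z₀ =>
  (((continuousAt_const (y := (1 : ℝ))).sub ht.continuousAt).smul (hB z₀)).add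
    (ht.continuousAt.smul (hB' z₀))

/-- A bilinear form on a finite-dimensional space is continuous. -/
noncomputable def bilinearToCLM [FiniteDimensional ℝ E] (B : E →ₗ[ℝ] E →ₗ[ℝ] ℝ) : E →L[ℝ] E →L[ℝ] ℝ :=
  LinearMap.toContinuousLinearMap
    ((LinearMap.toContinuousLinearMap : (E →ₗ[ℝ] ℝ) ≃ₗ[ℝ] (E →L[ℝ] ℝ)).toLinearMap ∘ₗ B)

lemma update_pair_zero {E : Type*} (v w u : E) : Function.update ![v, w] 0 u = ![u, w] := by
  ext k; fin_cases k <;> rfl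

lemma update_pair_one {E : Type*} (v w u : E) : Function.update ![v, w] 1 u = ![v, u] := by
  ext k; fin_cases k <;> rfl

variable [FiniteDimensional ℝ E]

/-- An alternating 2-form as a bilinear form. -/
noncomputable def alternatingToBilinear (a : E [⋀^Fin 2]→L[ℝ] ℝ) : E →L[ℝ] E →L[ℝ] ℝ :=
  bilinearToCLM <| LinearMap.mk₂ ℝ (fun v w => a ![v, w])
    (fun v v' w => by
      simpa only [update_pair_zero] using a.map_update_add ![v, w] 0 v v')
    (fun c v w => by
      simpa only [update_pair_zero] using a.map_update_smul ![v, w] 0 c v)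
    (fun v w w' => by
      simpa only [update_pair_one] using a.map_update_add ![v, w] 1 w w')
    (fun c v w => by
      simpa only [update_pair_one] using a.map_update_smul ![v, w] 1 c w)

lemma alternatingToBilinear_swap (a : E [⋀^Fin 2]→L[ℝ] ℝ) (v w : E) :
    alternatingToBilinear a v w = -alternatingToBilinear a w v := by
  have h (u : E) : alternatingToBilinear a u u = 0 :=
    a.map_eq_zero_of_eq ![u, u] (i := 0) (j := 1) rfl (by decide)
  have h1 := h (v + w)
  simp only [map_add, add_apply, h] at h1
  linarith

lemma continuousAt_bilinear_iff {B : Z → E →L[ℝ] E →L[ℝ] ℝ}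
    {z : Z} : ContinuousAt B z ↔ ∀ v w, ContinuousAt (fun z => B z v w) z := by
  rw [continuousAt_clm_apply]
  exact forall_congr' fun v => continuousAt_clm_apply

variable [IsManifold 𝓘(ℝ, E) 1 M]

lemma ContinuousBilinear.pullback {B : M → E →L[ℝ] E →L[ℝ] ℝ}
    (hB : ContinuousBilinear id B) {f : M → M} (hf : ContMDiff 𝓘(ℝ, E) 𝓘(ℝ, E) ∞ f) :
    ContinuousBilinear id fun x => (B (f x)).bilinearComp (modelDeriv f x) (modelDeriv f x) := by
  intro p
  refine continuousAt_bilinear_iff.2 fun v w => ?_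
  have h1 := ContinuousAt.comp (f := f) (hB (f p)) hf.continuous.continuousAt
  have h2 := continuousAt_mfderiv_inChart hf p
  refine ((h1.clm_apply (h2.clm_apply (continuousAt_const (y := v)))).clm_apply
    (h2.clm_apply (continuousAt_const (y := w)))).congr ?_
  filter_upwards [hf.continuous.continuousAt.preimage_mem_nhds
    ((chartAt E (f p)).open_source.mem_nhds (mem_chart_source E (f p)))] with x hfx
  simp [chartSymmDeriv_chartDeriv_apply hfx]

lemma skew_representingOperator {g Ω : E →L[ℝ] E →L[ℝ] ℝ} (hg : IsInnerForm g)
    (hΩ : ∀ v w, Ω v w = -Ω w v) (v w : E) :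
    g (representingOperator g Ω v) w = -g v (representingOperator g Ω w) := by
  rw [apply_representingOperator hg, hΩ, hg.symm v, apply_representingOperator hg]

lemma representingOperator_eq_zero {g Ω : E →L[ℝ] E →L[ℝ] ℝ} (hg : IsInnerForm g)
    (hΩ : ∀ v, (∀ w, Ω v w = 0) → v = 0) (v : E) (hv : representingOperator g Ω v = 0) : v = 0 :=
  hΩ v fun w => by rw [← apply_representingOperator hg, hv]; simp

/-- The almost-complex structures made from a metric and a nondegenerate 2-form depend
continuously on them. -/
lemma continuousOperators_polarPart (hπ : Continuous π) {g Ω : Z → E →L[ℝ] E →L[ℝ] ℝ}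
    (hg : ContinuousBilinear π g) (hΩ : ContinuousBilinear π Ω) (hgi : ∀ z, IsInnerForm (g z))
    (hsw : ∀ z v w, Ω z v w = -Ω z w v) (hnd : ∀ z v, (∀ w, Ω z v w = 0) → v = 0) :
    ContinuousOperators π fun z => polarPart (representingOperator (g z) (Ω z)) := by
  intro z₀
  let T : Z → E →L[ℝ] E := fun z => chartSymmDeriv (π z₀) (π z)
  let S : Z → E →L[ℝ] E := fun z => chartDeriv (π z₀) (π z)
  let A : Z → E →L[ℝ] E := fun z =>
    representingOperator ((g z).bilinearComp (T z) (T z)) ((Ω z).bilinearComp (T z) (T z))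
  have hkey (z : Z) (hz : π z ∈ (chartAt E (π z₀)).source) :
      IsInnerForm ((g z).bilinearComp (T z) (T z)) ∧ HasPolarPart (A z) ∧
      polarPart (A z) =
        readInChart (π z₀) (π z) (polarPart (representingOperator (g z) (Ω z))) := by
    have hST : S z * T z = 1 := chartDeriv_comp_chartSymmDeriv hz
    have hTS : T z * S z = 1 := chartSymmDeriv_comp_chartDeriv hz
    have hgc : IsInnerForm ((g z).bilinearComp (T z) (T z)) :=
      (hgi z).bilinearComp (Function.LeftInverse.injective (g := S z) (DFunLike.congr_fun hST))
    -- The representing operator of the forms read in the chart is the representing operator read in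
    -- the chart, so `polarPart_conj` applies.
    have hA : S z * representingOperator (g z) (Ω z) * T z = A z := by
      refine eq_representingOperator hgc fun v w => ?_
      have h1 (u : E) : T z (S z u) = u := DFunLike.congr_fun hTS u
      simp [h1, apply_representingOperator (hgi z)]
    have hp := hasPolarPart_of_skew (hgi z) (skew_representingOperator (hgi z) (hsw z))
      (representingOperator_eq_zero (hgi z) (hnd z))
    rw [← hA]
    exact ⟨hgc, hp.conj hST hTS, polarPart_conj hp hST hTS⟩
  have hev := hπ.continuousAt.eventually (eventually_mem_chart_source (E := E) (π z₀))
  have h0 := hkey z₀ (mem_chart_source E (π z₀))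
  have hA : ContinuousAt A z₀ := continuousAt_representingOperator h0.1 (hg z₀) (hΩ z₀)
  have hpol : ContinuousAt (fun z => polarPart (A z)) z₀ :=
    (continuousOn_polarPart (A z₀) h0.2.1).tendsto.comp
      (tendsto_nhdsWithin_iff.2 ⟨hA, hev.mono fun z hz => (hkey z hz).2.1⟩)
  exact hpol.congr (hev.mono fun z hz => (hkey z hz).2.2)

end Bilinear

/-! ### Reversing the complex structure reverses the canonical class -/

section Reversal

variable {E : Type*} [NormedAddCommGroup E] [NormedSpace ℂ E] 
  {Y : Type*} [TopologicalSpace Y] [ChartedSpace E Y]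

lemma modelDeriv_bijective (f : Y ≃ₘ^∞⟮𝓘(ℝ, E), 𝓘(ℝ, E)⟯ Y) (x : Y) :
    Function.Bijective (modelDeriv (E := E) f x) :=
  (f.mfderivToContinuousLinearEquiv (by simp) x).bijective

/-- A Hermitian metric, as a form on the model space. -/
def HermitianMetric.onModel (h : HermitianMetric E Y) (x : Y) : E →L⋆[ℂ] E →L[ℂ] ℂ := h.form x

lemma HermitianMetric.continuousAt_form [IsManifold 𝓘(ℂ, E) ω Y] (h : HermitianMetric E Y) (p : Y) (v w : E) :
    ContinuousAt (fun x => h.onModel x (chartSymmDeriv p x v) (chartSymmDeriv p x w)) p := by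
  have h1 := ((h.smooth p v w).continuousOn.continuousAt
    ((chartAt E p).open_target.mem_nhds (mem_chart_target E p))).comp
    ((chartAt E p).continuousAt (mem_chart_source E p))
  refine h1.congr ?_
  filter_upwards [eventually_mem_chart_source (E := E) p] with x hx
  rw [← mfderiv_chart_symm_apply hx, ← mfderiv_chart_symm_apply hx]
  change h.onModel ((chartAt E p).symm (chartAt E p x)) _ _ = _
  rw [(chartAt E p).left_inv hx]

variable [FiniteDimensional ℂ E]

/-- The real part of a Hermitian metric. -/
noncomputable def HermitianMetric.reForm (h : HermitianMetric E Y) (x : Y) :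
    E →L[ℝ] E →L[ℝ] ℝ :=
  let b : E →L⋆[ℂ] E →L[ℂ] ℂ := h.form x
  bilinearToCLM <| LinearMap.mk₂ ℝ (fun v w => (b v w).re)
    (fun v v' w => by simp)
    (fun c v w => by
      rw [← Complex.coe_smul, b.map_smulₛₗ, Complex.conj_ofReal, Complex.coe_smul]
      simp)
    (fun v w w' => by simp)
    (fun c v w => by
      rw [← Complex.coe_smul, map_smul, Complex.coe_smul]
      simp)

/-- The imaginary part of a Hermitian metric as a bilinear form. -/
noncomputable def HermitianMetric.imBilinear (h : HermitianMetric E Y) (x : Y) :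
    E →L[ℝ] E →L[ℝ] ℝ := alternatingToBilinear (E := E) (h.imForm x)

lemma HermitianMetric.reForm_apply (h : HermitianMetric E Y) (x : Y) (v w : E) :
    h.reForm x v w = (h.onModel x v w).re := rfl

lemma HermitianMetric.imBilinear_apply (h : HermitianMetric E Y) (x : Y) (v w : E) :
    h.imBilinear x v w = (h.onModel x v w).im := rfl

lemma HermitianMetric.isInnerForm_reForm (h : HermitianMetric E Y) (x : Y) :
    IsInnerForm (h.reForm x) where
  symm v w := by
    have h1 := congrArg Complex.re (h.conj_symm x v w)
    rw [Complex.conj_re] at h1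
    exact h1.symm
  pos v hv := h.pos x v hv

/-- Conjugate-linearity in the first variable gives `h(iv, w) = -i h(v, w)`. So multiplication by
`i` is the operator representing `Im h` with respect to `Re h`. -/
lemma HermitianMetric.reForm_I_smul (h : HermitianMetric E Y) (x : Y) (v w : E) :
    h.reForm x (Complex.I • v) w = h.imBilinear x v w := by
  rw [h.reForm_apply, h.imBilinear_apply, ContinuousLinearMap.map_smulₛₗ]
  simp

lemma HermitianMetric.imBilinear_nondegenerate (h : HermitianMetric E Y) (x : Y) (v : E)
    (hv : ∀ w, h.imBilinear x v w = 0) : v = 0 := by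
  by_contra h0
  have h1 := (h.isInnerForm_reForm x).pos (Complex.I • v) (smul_ne_zero Complex.I_ne_zero h0)
  rw [h.reForm_I_smul, hv] at h1
  exact h1.false

variable [IsManifold 𝓘(ℂ, E) ω Y]

lemma HermitianMetric.continuousBilinear_reForm (h : HermitianMetric E Y) :
    ContinuousBilinear id h.reForm := fun p => continuousAt_bilinear_iff.2 fun v w =>
  Complex.continuous_re.continuousAt.comp (h.continuousAt_form p v w)

lemma HermitianMetric.continuousBilinear_imBilinear (h : HermitianMetric E Y) :
    ContinuousBilinear id h.imBilinear := fun p => continuousAt_bilinear_iff.2 fun v w =>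
  Complex.continuous_im.continuousAt.comp (h.continuousAt_form p v w)

variable [T2Space Y] [SigmaCompactSpace Y]

/-- A path of almost-complex structures from `J` to `f^*(-J)` reverses the canonical class. -/
theorem cechPullback_eq_neg_of_path (f : Y ≃ₘ^∞⟮𝓘(ℝ, E), 𝓘(ℝ, E)⟯ Y)
    {κ : CechH2 Y} (hκ : IsCanonicalClass E κ) (J : unitInterval → Y → E →L[ℝ] E)
    (hJ : ∀ t x, J t x * J t x = -1)
    (hcont : ContinuousOperators Prod.snd fun q : unitInterval × Y => J q.1 q.2)
    (h0 : ∀ x v, J 0 x v = Complex.I • v)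
    (h1 : ∀ x v, modelDeriv f x (J 1 x v) = -(Complex.I • modelDeriv f x v)) :
    cechPullback (f.toHomeomorph : C(Y, Y)) κ = -κ := by
  have : IsManifold 𝓘(ℝ, E) 1 Y := isManifold_real_of_complex 1
  obtain ⟨Ψ, hΨc, hΨu, hΨ⟩ := exists_intertwining_of_path J hJ hcont
  refine cechPullback_eq_neg_of_conjLinear _ (fun x => (modelDeriv f x).comp (Ψ x))
    (fun x v => ?_) (fun x => ?_) (fun p => ?_) hκ
  · have h2 : Ψ x (J 0 x v) = J 1 x (Ψ x v) := DFunLike.congr_fun (hΨ x) v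
    rw [ContinuousLinearMap.comp_apply, ← h0, h2, h1]
    rfl
  · exact (modelDeriv_bijective f x).2.comp
      (ContinuousLinearMap.isUnit_iff_bijective.1 (hΨu x)).2
  · refine ((continuousAt_mfderiv_inChart f.contMDiff p).clm_comp (hΨc p)).congr ?_
    filter_upwards [eventually_mem_chart_source (E := E) p] with x hx
    exact (chart_comp_comp hx _ _).symm

/-- A path of nondegenerate 2-forms from `ω = Im h` to `f^*(-ω)` reverses the canonical class. -/
theorem cechPullback_eq_neg_of_symplectic_path (h : HermitianMetric E Y)
    (f : Y ≃ₘ^∞⟮𝓘(ℝ, E), 𝓘(ℝ, E)⟯ Y) {κ : CechH2 Y} (hκ : IsCanonicalClass E κ)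
    (Ω : unitInterval → Y → E →L[ℝ] E →L[ℝ] ℝ)
    (hsw : ∀ t x v w, Ω t x v w = -Ω t x w v) (hnd : ∀ t x v, (∀ w, Ω t x v w = 0) → v = 0)
    (hcont : ContinuousBilinear Prod.snd fun q : unitInterval × Y => Ω q.1 q.2)
    (h0 : ∀ x v w, Ω 0 x v w = h.imBilinear x v w)
    (h1 : ∀ x v w, Ω 1 x v w = -h.imBilinear (f x) (modelDeriv f x v) (modelDeriv f x w)) :
    cechPullback (f.toHomeomorph : C(Y, Y)) κ = -κ := by
  have : IsManifold 𝓘(ℝ, E) 1 Y := isManifold_real_of_complex 1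
  let g' : Y → E →L[ℝ] E →L[ℝ] ℝ := fun x =>
    (h.reForm (f x)).bilinearComp (modelDeriv f x) (modelDeriv f x)
  -- The ends are chosen to match `Ω`: `Re h` goes with `Im h` and represents it by `i`, while
  -- `f^*(Re h)` goes with `f^*(-Im h)` and represents it by the pull-back of `-i`.
  let g : unitInterval → Y → E →L[ℝ] E →L[ℝ] ℝ := fun t x =>
    (1 - (t : ℝ)) • h.reForm x + (t : ℝ) • g' x
  have hg'i (x : Y) : IsInnerForm (g' x) :=
    (h.isInnerForm_reForm (f x)).bilinearComp (modelDeriv_bijective f x).1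
  have hgi (t : unitInterval) (x : Y) : IsInnerForm (g t x) :=
    (h.isInnerForm_reForm x).segment (hg'i x) t
  have hgc : ContinuousBilinear Prod.snd fun q : unitInterval × Y => g q.1 q.2 :=
    (h.continuousBilinear_reForm.comp continuous_snd).segment
      ((h.continuousBilinear_reForm.pullback f.contMDiff).comp continuous_snd)
      (t := fun q : unitInterval × Y => (q.1 : ℝ)) (by fun_prop)
  let A : unitInterval → Y → E →L[ℝ] E := fun t x => representingOperator (g t x) (Ω t x)
  have hg0 (x : Y) : g 0 x = h.reForm x := by ext v w; simp [g]
  have hg1 (x : Y) : g 1 x = g' x := by ext v w; simp [g]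
  have hA0 (x : Y) (v : E) : A 0 x v = Complex.I • v := by
    have h2 := eq_representingOperator (Ω := Ω 0 x) (hgi 0 x)
      (A := (Complex.I • ContinuousLinearMap.id ℂ E).restrictScalars ℝ) fun v w => by
        rw [hg0, h0]
        exact h.reForm_I_smul x v w
    exact (DFunLike.congr_fun h2 v).symm
  have hA1 (x : Y) (v : E) : modelDeriv f x (A 1 x v) = -(Complex.I • modelDeriv f x v) := by
    -- The defect of the claimed identity is written as `df u`; testing the equation that defines `A
    -- 1 x` on `u` shows that the defect has zero length for `Re h`.
    obtain ⟨u, hu⟩ := (modelDeriv_bijective f x).2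
      (modelDeriv f x (A 1 x v) + Complex.I • modelDeriv f x v)
    refine eq_neg_of_add_eq_zero_left ?_
    by_contra hne
    have h2 := (h.isInnerForm_reForm (f x)).pos _ hne
    have h3 : g 1 x (A 1 x v) u = Ω 1 x v u := apply_representingOperator (hgi 1 x) _ _ _
    rw [hg1, h1, ContinuousLinearMap.bilinearComp_apply, hu] at h3
    have h4 := map_add (h.reForm (f x)) (modelDeriv f x (A 1 x v))
      (Complex.I • modelDeriv f x v)
    rw [h4, add_apply, h3, h.reForm_I_smul] at h2
    simp at h2
  have hA0sq (x : Y) : A 0 x * A 0 x = -1 := by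
    ext v
    simp [hA0, smul_smul]
  have hA1sq (x : Y) : A 1 x * A 1 x = -1 := by
    ext v
    apply (modelDeriv_bijective f x).1
    simp [hA1, smul_smul]
  refine cechPullback_eq_neg_of_path f hκ (fun t x => polarPart (A t x)) (fun t x => ?_) ?_
    (fun x v => ?_) (fun x v => ?_)
  · exact polarPart_sq_of_skew (hgi t x) (skew_representingOperator (hgi t x) (hsw t x))
      (representingOperator_eq_zero (hgi t x) (hnd t x))
  · exact continuousOperators_polarPart continuous_snd hgc hcont (fun q => hgi q.1 q.2)
      (fun q => hsw q.1 q.2) (fun q => hnd q.1 q.2)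
  · rw [polarPart_of_sq (hA0sq x), hA0]
  · rw [polarPart_of_sq (hA1sq x), hA1]

end Reversal

/-! ### Deformations as continuous families on the tangent bundle -/

section Deformations

variable {E : Type*} [NormedAddCommGroup E] [NormedSpace ℝ E]
  {M : Type*} [TopologicalSpace M] [ChartedSpace E M]

lemma continuousAt_snd_chart {E M : Type*} [TopologicalSpace E] [TopologicalSpace M]
    [ChartedSpace E M] (t : unitInterval) (p : M) :
    ContinuousAt (fun q : unitInterval × M => (q.1, chartAt E p q.2)) (t, p) :=
  continuousAt_fst.prodMk
    (ContinuousAt.comp (f := Prod.snd) ((chartAt E p).continuousAt (mem_chart_source E p))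
      continuousAt_snd)

lemma univ_prod_chart_target_mem_nhds {E M : Type*} [TopologicalSpace E] [TopologicalSpace M]
    [ChartedSpace E M] (t : unitInterval) (p : M) :
    (Set.univ ×ˢ (chartAt E p).target : Set (unitInterval × E)) ∈ 𝓝 (t, chartAt E p p) :=
  prod_mem_nhds Filter.univ_mem ((chartAt E p).open_target.mem_nhds (mem_chart_target E p))

/-- The value at `x` of a field of endomorphisms, as an operator on the model space. -/
def EndField.onModel (J : EndField E M) (x : M) : E →L[ℝ] E := J x

lemma IsAlmostComplexDeformation.continuousOperators {J : unitInterval → EndField E M}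
    (hJ : IsAlmostComplexDeformation J) :
    ContinuousOperators (E := E) Prod.snd fun q : unitInterval × M =>
      (J q.1).onModel q.2 := by
  rintro ⟨t, p⟩
  have h := ContinuousAt.comp (f := fun q : unitInterval × M => (q.1, chartAt E p q.2))
    ((hJ.continuous p).continuousAt (univ_prod_chart_target_mem_nhds t p))
    (continuousAt_snd_chart t p)
  refine h.congr ?_
  filter_upwards [continuousAt_snd.eventually (eventually_mem_chart_source (E := E) p)] with q hq
  have h1 (y : M) (hy : y = q.2) : (chartDeriv p y).comp
      (((J q.1).onModel y).comp (chartSymmDeriv p q.2)) =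
      readInChart p q.2 ((J q.1).onModel q.2) := by
    rw [hy]; rfl
  exact h1 _ ((chartAt E p).left_inv hq)

lemma IsSymplecticDeformation.continuousBilinear [FiniteDimensional ℝ E]
    {a : unitInterval → FormField ℝ (E := E) M 2 ℝ} (ha : IsSymplecticDeformation a) :
    ContinuousBilinear (E := E) Prod.snd
      fun q : unitInterval × M => alternatingToBilinear (E := E) (a q.1 q.2) := by
  rintro ⟨t, p⟩
  refine continuousAt_bilinear_iff.2 fun v w => ?_
  have h := ContinuousAt.comp (f := fun q : unitInterval × M => (q.1, chartAt E p q.2))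
    ((ha.continuous p).continuousAt (univ_prod_chart_target_mem_nhds t p))
    (continuousAt_snd_chart t p)
  have h2 := ((continuous_eval_const (F := E [⋀^Fin 2]→L[ℝ] ℝ) ![v, w]).continuousAt.comp h)
  refine h2.congr ?_
  filter_upwards [continuousAt_snd.eventually (eventually_mem_chart_source (E := E) p)] with q hq
  have h1 (y : M) (hy : y = q.2) : (show E [⋀^Fin 2]→L[ℝ] ℝ from a q.1 y)
      (fun k => chartSymmDeriv p q.2 (![v, w] k)) =
      alternatingToBilinear (E := E) (a q.1 q.2) (chartSymmDeriv p q.2 v) (chartSymmDeriv p q.2 w) := by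
    subst hy
    exact congrArg (show E [⋀^Fin 2]→L[ℝ] ℝ from a q.1 q.2) (by ext k; fin_cases k <;> rfl)
  exact h1 _ ((chartAt E p).left_inv hq)

end Deformations

theorem proposition4p5
    {E : Type*} [NormedAddCommGroup E] [NormedSpace ℂ E] [FiniteDimensional ℂ E]
    {Y : Type*} [TopologicalSpace Y] [T2Space Y] [SigmaCompactSpace Y]
    [ChartedSpace E Y] [IsManifold 𝓘(ℂ, E) ω Y]
    (h : HermitianMetric E Y) (hh : h.IsKahler)
    (κ : CechH2 Y) (hκ : IsCanonicalClass E κ)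
    (hrev : ∀ f : Y ≃ₘ^∞⟮𝓘(ℝ, E), 𝓘(ℝ, E)⟯ Y,
      cechPullback (f.toHomeomorph : C(Y, Y)) κ ≠ -κ) :
    ¬ SymplecticEquivalent h.imForm (-h.imForm) ∧
    ¬ Symplectomorphic h.imForm (-h.imForm) ∧
    ¬ AlmostComplexEquivalent (complexStructure E Y) (-complexStructure E Y) ∧
    ¬ AlmostComplexIsomorphic (complexStructure E Y) (-complexStructure E Y) := by
  have hsymp (f : Y ≃ₘ^∞⟮𝓘(ℝ, E), 𝓘(ℝ, E)⟯ Y) (s : unitInterval → FormField ℝ (E := E) Y 2 ℝ)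
      (hc : ContinuousBilinear (E := E) Prod.snd
        fun q : unitInterval × Y => alternatingToBilinear (E := E) (s q.1 q.2))
      (hnd : ∀ t x (v : E), (∀ w, alternatingToBilinear (E := E) (s t x) v w = 0) → v = 0)
      (h0 : s 0 = h.imForm) (h1 : IsPullbackForm f (s 1) (-h.imForm)) : False := by
    refine hrev f (cechPullback_eq_neg_of_symplectic_path h f hκ
      (fun t x => alternatingToBilinear (E := E) (s t x)) (fun t x => alternatingToBilinear_swap _) hnd hc
      (fun x v w => by rw [h0]; rfl) fun x v w => ?_)
    rw [h1 x]
    change -(h.imForm (f x) _) = -(h.imForm (f x) _)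
    congr 2
    ext k
    fin_cases k <;> rfl
  have halm (f : Y ≃ₘ^∞⟮𝓘(ℝ, E), 𝓘(ℝ, E)⟯ Y) (s : unitInterval → EndField E Y)
      (hc : ContinuousOperators (E := E) Prod.snd fun q : unitInterval × Y =>
        (s q.1).onModel q.2)
      (hsq : ∀ t x (v : E), s t x (s t x v) = -v) (h0 : s 0 = complexStructure E Y)
      (h1 : ∀ (x : Y) (v : E), modelDeriv f x ((s 1).onModel x v) = -(Complex.I • modelDeriv f x v)) :
      False := by
    refine hrev f (cechPullback_eq_neg_of_path f hκ (fun t x => (s t).onModel x) (fun t x => ?_) hc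
      (fun x v => ?_) h1)
    · ext v
      exact hsq t x v
    · rw [h0]
      rfl
  refine ⟨?_, ?_, ?_, ?_⟩
  · rintro ⟨s, hs, h0, f, h1⟩
    exact hsymp f s hs.continuousBilinear (fun t x => (hs.symplectic t).nondegenerate x) h0 h1
  · rintro ⟨f, h1⟩
    -- A symplectomorphism is treated as an equivalence along the constant path.
    exact hsymp f (fun _ => h.imForm) (h.continuousBilinear_imBilinear.comp continuous_snd)
      (fun _ x => h.imBilinear_nondegenerate x) rfl h1
  · rintro ⟨s, hs, h0, f, h1⟩
    exact halm f s hs.continuousOperators (fun t x => (hs.almostComplex t).sq x) h0 h1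
  · rintro ⟨f, h1⟩
    refine halm f (fun _ => complexStructure E Y) ?_ (fun t x v => ?_) rfl h1
    -- Derivatives of holomorphic charts commute with `i`, so the complex structure reads as the
    -- constant `i` in the chart at `p`.
    · have hm : IsManifold 𝓘(ℝ, E) 1 Y := isManifold_real_of_complex 1
      rintro ⟨t, p⟩
      refine (continuousAt_const (y := (Complex.I • ContinuousLinearMap.id ℂ E).restrictScalars
        ℝ)).congr ?_
      filter_upwards [continuousAt_snd.eventually (eventually_mem_chart_source (E := E) p)]
        with q hq
      ext v
      change Complex.I • v = chartDeriv p q.2 (Complex.I • chartSymmDeriv p q.2 v)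
      rw [← chartSymmDeriv_smul_I hq, chartDeriv_chartSymmDeriv_apply hq]
    · change Complex.I • Complex.I • v = -v
      simp [smul_smul]
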